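/- Let $X$ be a locally compact Hausdorff space and let $\sigma=(\sigma_1,\dots,\sigma_n)$ be proper continuous maps $X\to X$ with $X=\bigcup_{i=1}^n\sigma_i(X)$. *Covering system.* Let $\tilde X$ be the set of all $(\mathbf i,\mathbf x)\in\{1,\dots,n\}^{\mathbb N}\times X^{\mathbb N}$ with $\sigma_{i_k}(x_{k+1})=x_k$ for all $k\ge 0$, with the subspace topology of the product topology, and define $\tilde\sigma_i:\tilde X\to\tilde X$ by $\tilde\sigma_i(\mathbf i,\mathbf x)=\big((i,i_0,i_1,\dots),(\sigma_i(x_0),x_0,x_1,\dots)\big)$. A set $F\subseteq\tilde X$ is $\tilde\sigma$-bi-invariant if $\tilde\sigma_i(F)\subseteq F$ and $\tilde\sigma_i^{-1}(F)\subseteq F$ for $1\le i\le n$. *Tensor algebra and C\*-envelope.* A row contractive representation of $(\tilde X,\tilde\sigma)$ on a complex Hilbert space $H$ is a pair consisting of a $*$-homomorphism $\pi:\mathrm C_0(\tilde X)\to\mathcal B(H)$ and operators $T_1,\dots,T_n$ on $H$ with $\|[T_1\ \cdots\ T_n]\|\le 1$ and $\pi(f)T_i=T_i\,\pi(f\circ\tilde\sigma_i)$;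 it sends a formal finite sum $\sum_w\mathfrak t_wf_w$ (over words $w$ in $1,\dots,n$, with $f_w\in \mathrm C_0(\tilde X)$) to $\sum_wT_w\pi(f_w)$, where $T_w=T_{i_1}\cdots T_{i_k}$ for $w=i_1\cdots i_k$. The tensor algebra $\mathcal A(\tilde X,\tilde\sigma)$ is the completion of the space of these sums (an algebra under $\mathfrak t_vf\cdot\mathfrak t_wg=\mathfrak t_{vw}(f\circ\tilde\sigma_w)g$) whose matrix norms are the suprema over all row contractive representations. Let $\mathfrak A$ be its C\*-envelope: the C\*-algebra generated by a completely isometric representation $j_0$ such that for every completely isometric representation $j$ there is a surjective $*$-homomorphism $q:\mathrm C^*(j(\mathcal A(\tilde X,\tilde\sigma)))\to\mathfrak A$ with $qj=j_0$. Write $f$ and $\mathfrak t_i$ for the images $\pi(f)$ and $T_i$ under $j_0$. *The algebra $\mathfrak B$ and the endomorphism $\alpha$.* Put $$\mathfrak B=\overline{\operatorname{span}}\{\mathfrak t_uf\mathfrak t_v^*: |u|=|v|,\ f\in \mathrm C_0(\tilde X)\},\qquad V=\tfrac1{\sqrt n}\sum_{i=1}^n\mathfrak t_i,\qquad \alpha(b)=VbV^*\quad(b\in\mathfrak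 B).$$ A closed two-sided ideal $\mathfrak J$ of $\mathfrak B$ is $\alpha$-bi-invariant if $\alpha(\mathfrak J)\subseteq\mathfrak J$ and, for $b\in\mathfrak B$, $\alpha(b)\in\mathfrak J$ implies $b\in\mathfrak J$. **Corollary.** For every $\alpha$-bi-invariant ideal $\mathfrak J$ of $\mathfrak B$ there is a unique closed $\tilde\sigma$-bi-invariant set $F\subseteq\tilde X$ such that $$\mathfrak J\cap \mathrm C_0(\tilde X)=I_F:=\{f\in \mathrm C_0(\tilde X): f|_F=0\},$$ and the map $\mathfrak J\mapsto F$ is a bijection from the $\alpha$-bi-invariant ideals of $\mathfrak B$ onto the closed $\tilde\sigma$-bi-invariant subsets of $\tilde X$. -/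

import Mathlib

universe u

open scoped ZeroAtInfty

/-- A multivariable dynamical system: `n` proper continuous self-maps of `X`
(`IsProperMap` includes continuity). -/
structure MultiSystem (n : ℕ) (X : Type u) [TopologicalSpace X] where
  /-- the maps `σ_1, …, σ_n` -/
  map : Fin n → X → X
  proper : ∀ i, IsProperMap (map i)

theorem tendsto_cocompact_of_isProperMap {X Y : Type*} [TopologicalSpace X] [TopologicalSpace Y]
    {g : X → Y} (hg : IsProperMap g) :
    Filter.Tendsto g (Filter.cocompact X) (Filter.cocompact Y) := by
  refine Filter.hasBasis_cocompact.tendsto_right_iff.2 fun K hK => ?_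
  exact (hg.isCompact_preimage hK).compl_mem_cocompact

namespace MultiSystem

variable {n : ℕ} {X : Type u} [TopologicalSpace X]

/-- `X` is the union of the ranges of the maps. -/
def IsSurjective (S : MultiSystem n X) : Prop :=
  ∀ x : X, ∃ i : Fin n, ∃ y : X, S.map i y = x

/-- `σ_i(A) ⊆ A` and `σ_i⁻¹(A) ⊆ A` for all `i`. -/
def BiInvariant (S : MultiSystem n X) (A : Set X) : Prop :=
  ∀ i : Fin n, S.map i '' A ⊆ A ∧ S.map i ⁻¹' A ⊆ A

/-- The function `f ∘ σ_i` of `C₀(X)`. -/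
noncomputable def pull (S : MultiSystem n X) (i : Fin n) (f : C₀(X, ℂ)) : C₀(X, ℂ) where
  toFun := fun x => f (S.map i x)
  continuous_toFun := f.continuous.comp (S.proper i).continuous
  zero_at_infty' := f.zero_at_infty'.comp (tendsto_cocompact_of_isProperMap (S.proper i))

/-- The infinite tails `(i, x)`, i.e. `σ_{i_k}(x_{k+1}) = x_k` for all `k ≥ 0`,
with the topology of the product `n^ℕ × X^ℕ`. -/
def Tail (S : MultiSystem n X) : Type u :=
  {z : (ℕ → Fin n) × (ℕ → X) // ∀ k, S.map (z.1 k) (z.2 (k + 1)) = z.2 k}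

instance (S : MultiSystem n X) : TopologicalSpace S.Tail :=
  inferInstanceAs (TopologicalSpace
    {z : (ℕ → Fin n) × (ℕ → X) // ∀ k, S.map (z.1 k) (z.2 (k + 1)) = z.2 k})

/-- Put a new term in front of a sequence. -/
def cons {Y : Type*} (a : Y) (s : ℕ → Y) : ℕ → Y
  | 0 => a
  | k + 1 => s k

/-- `(i, x) ↦ ((i, i_0, i_1, …), (σ_i(x_0), x_0, x_1, …))`. -/
def tailMap (S : MultiSystem n X) (i : Fin n) (z : S.Tail) : S.Tail :=
  ⟨(cons i z.1.1, cons (S.map i (z.1.2 0)) z.1.2), by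
    intro k
    cases k with
    | zero => rfl
    | succ k => exact z.2 k⟩

theorem continuous_cons {Y Z : Type*} [TopologicalSpace Y] [TopologicalSpace Z]
    {a : Z → Y} {s : Z → ℕ → Y} (ha : Continuous a) (hs : Continuous s) :
    Continuous fun z => cons (a z) (s z) := by
  refine continuous_pi fun k => ?_
  cases k with
  | zero => exact ha
  | succ k => exact (continuous_apply k).comp hs

theorem isProperMap_tailMap (S : MultiSystem n X) (i : Fin n) : IsProperMap (S.tailMap i) := by
  have hval : Continuous fun z : S.Tail => z.1 := continuous_subtype_val
  have h1 : Continuous fun z : S.Tail => z.1.1 := continuous_fst.comp hval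
  have h2 : Continuous fun z : S.Tail => z.1.2 := continuous_snd.comp hval
  have hc : Continuous (S.tailMap i) :=
    Continuous.subtype_mk ((continuous_cons continuous_const h1).prodMk
      (continuous_cons ((S.proper i).continuous.comp ((continuous_apply 0).comp h2)) h2)) _
  let shift : S.Tail → S.Tail := fun z =>
    ⟨(fun k => z.1.1 (k + 1), fun k => z.1.2 (k + 1)), fun k => z.2 (k + 1)⟩
  have hs : Continuous shift :=
    Continuous.subtype_mk
      ((continuous_pi fun k => (continuous_apply (k + 1)).comp h1).prodMk
        (continuous_pi fun k => (continuous_apply (k + 1)).comp h2)) _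
  have hleft : Function.LeftInverse shift (S.tailMap i) := fun _ => rfl
  have hr : Set.range (S.tailMap i) = {z : S.Tail | z.1.1 0 = i} := by
    ext z
    constructor
    · rintro ⟨y, rfl⟩
      rfl
    · intro hz
      refine ⟨shift z, Subtype.ext (Prod.ext ?_ ?_)⟩
      · funext k
        cases k with
        | zero => exact hz.symm
        | succ k => rfl
      · funext k
        cases k with
        | zero =>
          have hz' : z.1.1 0 = i := hz
          have := z.2 0
          rw [hz'] at this
          exact this
        | succ k => rfl
  have hcl : IsClosed (Set.range (S.tailMap i)) := by
    rw [hr]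
    exact isClosed_singleton.preimage ((continuous_apply 0).comp h1)
  exact (Topology.IsClosedEmbedding.mk (hleft.isEmbedding hs hc) hcl).isProperMap

/-- The covering system `(X̃, σ̃)`. -/
def covering (S : MultiSystem n X) : MultiSystem n S.Tail where
  map := S.tailMap
  proper := S.isProperMap_tailMap

end MultiSystem

/-- The covariance algebra `A_0(X, σ)` as a vector space: `a` is the finite sum `∑_w s_w f_w`
with `f_w = a w`, over words `w` in `{1, …, n}`. -/
abbrev CovAlg (n : ℕ) (X : Type u) [TopologicalSpace X] : Type u :=
  List (Fin n) →₀ C₀(X, ℂ)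

/-- The operator on the Hilbert sum `H^m` given by an `m × m` matrix of operators on `H`. -/
noncomputable def matrixOp {H : Type u} [NormedAddCommGroup H] [InnerProductSpace ℂ H] {m : ℕ}
    (a : Matrix (Fin m) (Fin m) (H →L[ℂ] H)) :
    PiLp 2 (fun _ : Fin m => H) →L[ℂ] PiLp 2 (fun _ : Fin m => H) :=
  (PiLp.continuousLinearEquiv 2 ℂ (fun _ : Fin m => H)).symm.toContinuousLinearMap ∘L
    (ContinuousLinearMap.pi fun i => ∑ j, a i j ∘L ContinuousLinearMap.proj j) ∘L
    (PiLp.continuousLinearEquiv 2 ℂ (fun _ : Fin m => H)).toContinuousLinearMap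

/-- A row contractive representation of the covariance algebra of `(X, σ)` on `H`: a
`*`-representation `π` of `C₀(X)` and a row contraction `[T_1 … T_n]` (the images of
`s_1, …, s_n`) with `π(f) T_i = T_i π(f ∘ σ_i)`. -/
structure RowContractiveRep {n : ℕ} {X : Type u} [TopologicalSpace X] (S : MultiSystem n X)
    (H : Type u) [NormedAddCommGroup H] [InnerProductSpace ℂ H] [CompleteSpace H] where
  π : C₀(X, ℂ) →⋆ₙₐ[ℂ] (H →L[ℂ] H)
  T : Fin n → (H →L[ℂ] H)
  covariant : ∀ (f : C₀(X, ℂ)) (i : Fin n), π f * T i = T i * π (S.pull i f)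
  row_contractive : ∀ h : Fin n → H, ‖∑ i, T i (h i)‖ ^ 2 ≤ ∑ i, ‖h i‖ ^ 2

namespace RowContractiveRep

variable {n : ℕ} {X : Type u} [TopologicalSpace X] {S : MultiSystem n X}
variable {H : Type u} [NormedAddCommGroup H] [InnerProductSpace ℂ H] [CompleteSpace H]

/-- `T_w = T_{i_1} ⋯ T_{i_k}` for the word `w = i_1 ⋯ i_k`. -/
def word (ρ : RowContractiveRep S H) (w : List (Fin n)) : H →L[ℂ] H :=
  (w.map ρ.T).prod

/-- The image `∑_w T_w π(f_w)` of `∑_w s_w f_w`. -/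
noncomputable def eval (ρ : RowContractiveRep S H) (a : CovAlg n X) : H →L[ℂ] H :=
  a.sum fun w f => ρ.word w * ρ.π f

/-- The norm of the image of a matrix over the covariance algebra, as an operator on `H^m`. -/
noncomputable def matrixNorm (ρ : RowContractiveRep S H) {m : ℕ}
    (A : Matrix (Fin m) (Fin m) (CovAlg n X)) : ℝ :=
  ‖matrixOp (A.map ρ.eval)‖

end RowContractiveRep

/-- The matrix norms of the tensor algebra `A(X, σ)`: the supremum over all row contractive
representations. The tensor algebra is the completion of the covariance algebra for them.
(Hilbert spaces in the universe of `X` suffice: they include `ℓ²(X × words)`, on which all the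
orbit representations live.) -/
noncomputable def tensorNorm {n : ℕ} {X : Type u} [TopologicalSpace X] (S : MultiSystem n X)
    {m : ℕ} (A : Matrix (Fin m) (Fin m) (CovAlg n X)) : ℝ :=
  sSup {r : ℝ | ∃ (H : Type u) (_ : NormedAddCommGroup H) (_ : InnerProductSpace ℂ H)
    (_ : CompleteSpace H) (ρ : RowContractiveRep S H), r = ρ.matrixNorm A}

namespace RowContractiveRep

variable {n : ℕ} {X : Type u} [TopologicalSpace X] {S : MultiSystem n X}
variable {H : Type u} [NormedAddCommGroup H] [InnerProductSpace ℂ H] [CompleteSpace H]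

/-- `ρ` is completely isometric on the tensor algebra. -/
def IsCompletelyIsometric (ρ : RowContractiveRep S H) : Prop :=
  ∀ (m : ℕ) (A : Matrix (Fin m) (Fin m) (CovAlg n X)), ρ.matrixNorm A = tensorNorm S A

/-- The C*-algebra generated by the image of the tensor algebra. -/
noncomputable def cstar (ρ : RowContractiveRep S H) : NonUnitalStarSubalgebra ℂ (H →L[ℂ] H) :=
  (NonUnitalStarAlgebra.adjoin ℂ (Set.range ρ.eval)).topologicalClosure

/-- The C*-algebra generated by `ρ` is (with `ρ`) the C*-envelope of the tensor algebra: `ρ` is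
completely isometric, and for each completely isometric representation `ρ'` there is a
surjective `*`-homomorphism `q` from the C*-algebra generated by `ρ'` with `q ∘ ρ' = ρ`. -/
def IsCStarEnvelope (ρ : RowContractiveRep S H) : Prop :=
  ρ.IsCompletelyIsometric ∧
    ∀ (H' : Type u) [NormedAddCommGroup H'] [InnerProductSpace ℂ H'] [CompleteSpace H']
      (ρ' : RowContractiveRep S H'), ρ'.IsCompletelyIsometric →
      ∃ q : ρ'.cstar →⋆ₙₐ[ℂ] ρ.cstar, Function.Surjective q ∧
        ∀ (a : CovAlg n X) (x : ρ'.cstar), (x : H' →L[ℂ] H') = ρ'.eval a →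
          (q x : H →L[ℂ] H) = ρ.eval a

/-- `𝔅`, the closed span of the elements `t_u f t_v*` with `|u| = |v|`. -/
noncomputable def 𝔅 (ρ : RowContractiveRep S H) : Submodule ℂ (H →L[ℂ] H) :=
  (Submodule.span ℂ {b | ∃ (u v : List (Fin n)) (f : C₀(X, ℂ)), u.length = v.length ∧
    b = ρ.word u * ρ.π f * star (ρ.word v)}).topologicalClosure

/-- `V = n^{-1/2} ∑_i t_i`. -/
noncomputable def V (ρ : RowContractiveRep S H) : H →L[ℂ] H :=
  ((Real.sqrt n : ℂ)⁻¹) • ∑ i, ρ.T i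

/-- `α(b) = V b V*`. -/
noncomputable def α (ρ : RowContractiveRep S H) (b : H →L[ℂ] H) : H →L[ℂ] H :=
  ρ.V * b * star ρ.V

/-- Closed two-sided ideals of `𝔅`. -/
structure IsIdeal (ρ : RowContractiveRep S H) (J : Submodule ℂ (H →L[ℂ] H)) : Prop where
  le : J ≤ ρ.𝔅
  closed : IsClosed (J : Set (H →L[ℂ] H))
  mul_left : ∀ b ∈ ρ.𝔅, ∀ a ∈ J, b * a ∈ J
  mul_right : ∀ b ∈ ρ.𝔅, ∀ a ∈ J, a * b ∈ J

/-- `α`-bi-invariant ideals: `α(J) ⊆ J`, and `α(b) ∈ J` implies `b ∈ J` for `b ∈ 𝔅`. -/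
structure IsBiInvariantIdeal (ρ : RowContractiveRep S H) (J : Submodule ℂ (H →L[ℂ] H)) : Prop
    extends ρ.IsIdeal J where
  map_mem : ∀ b ∈ J, ρ.α b ∈ J
  mem_of_map_mem : ∀ b ∈ ρ.𝔅, ρ.α b ∈ J → b ∈ J

end RowContractiveRep

/-!
The maps of the covering system are injective with disjoint ranges. For such a system the
multiplication operators and the shifts `e_{x,k} ↦ e_{σ_i x, k+1}` on `ℓ²(X × ℤ)` satisfy the Cuntz
relations, and they form a completely isometric representation: given a row contractive
representation with operators `T_i` and `0 ≤ r < 1`, the Poisson kernel of the operators `r T_i`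
exhibits the representation with `r T_i` as a compression of representations on orbits, which are
parts of the shift representation, and `r` tends to `1`. Therefore the Cuntz relations pass to the
C*-envelope through its quotient map.

By the Cuntz relations, `𝔅` is the closure of an increasing union of levels, the `k`-th of which
consists of the matrices over `C₀(X)` indexed by the words of length `k`. A closed ideal of `𝔅` is
the closure of the union of its intersections with the levels, and bi-invariance turns the matrix
entries of an element into functions in the ideal and back. So a bi-invariant ideal is generated by
its functions, and these form `I_F` for a bi-invariant closed set `F`.
-/

/-! ### Closed ideals of `C₀(X)` -/

section ZeroAtInfty

variable {X : Type*} [TopologicalSpace X]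

theorem zeroAtInfty_norm_apply_le {E : Type*} [NormedAddCommGroup E] (f : C₀(X, E)) (x : X) :
    ‖f x‖ ≤ ‖f‖ :=
  f.toBCF.norm_coe_le_norm x

theorem zeroAtInfty_norm_le {E : Type*} [NormedAddCommGroup E] {f : C₀(X, E)} {C : ℝ}
    (hC : 0 ≤ C) : ‖f‖ ≤ C ↔ ∀ x, ‖f x‖ ≤ C :=
  BoundedContinuousFunction.norm_le (f := f.toBCF) hC

theorem zeroAtInfty_sum_apply {κ : Type*} (t : Finset κ) (f : κ → C₀(X, ℂ)) (x : X) :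
    (∑ i ∈ t, f i) x = ∑ i ∈ t, f i x :=
  map_sum (⟨⟨fun h => h x, rfl⟩, fun _ _ => rfl⟩ : C₀(X, ℂ) →+ ℂ) f t

theorem isCompact_setOf_le_norm (f : C₀(X, ℂ)) {ε : ℝ} (hε : 0 < ε) :
    IsCompact {x | ε ≤ ‖f x‖} := by
  obtain ⟨K, hK, hKε⟩ := Filter.mem_cocompact.1 <|
    f.zero_at_infty'.norm.eventually (Iio_mem_nhds (norm_zero (E := ℂ) ▸ hε))
  exact hK.of_isClosed_subset (isClosed_le continuous_const f.continuous.norm)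
    fun x (hx : ε ≤ ‖f x‖) => by_contra fun hxK => hx.not_gt (hKε hxK)

/-- The function `conj f / max (|f|², δ²)` of `C₀(X)`: a pseudo-inverse of `f`, exact where
`δ ≤ |f|`. -/
noncomputable def truncInv (f : C₀(X, ℂ)) {δ : ℝ} (hδ : 0 < δ) : C₀(X, ℂ) where
  toFun x := star (f x) / (max (‖f x‖ ^ 2) (δ ^ 2) : ℝ)
  continuous_toFun := by
    refine f.continuous.star.div (by fun_prop) fun x => ?_
    exact_mod_cast (lt_max_of_lt_right (pow_pos hδ 2)).ne'
  zero_at_infty' := by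
    refine squeeze_zero_norm (fun x => ?_)
      (by simpa using f.zero_at_infty'.norm.div_const (δ ^ 2) :
        Filter.Tendsto (fun x => ‖f x‖ / δ ^ 2) _ _)
    rw [norm_div, norm_star, Complex.norm_real, Real.norm_of_nonneg (by positivity)]
    gcongr
    exact le_max_right _ _

theorem mul_truncInv_apply (f : C₀(X, ℂ)) {δ : ℝ} (hδ : 0 < δ) (x : X) :
    (f * truncInv f hδ) x = (‖f x‖ ^ 2 / max (‖f x‖ ^ 2) (δ ^ 2) : ℝ) := by
  change f x * (star (f x) / _) = _
  rw [mul_div_assoc', Complex.star_def, Complex.mul_conj']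
  push_cast
  rfl

theorem one_sub_mul_truncInv_apply_of_le (f : C₀(X, ℂ)) {δ : ℝ} (hδ : 0 < δ) {x : X}
    (hx : δ ≤ ‖f x‖) : 1 - (f * truncInv f hδ) x = 0 := by
  have hpos : 0 < ‖f x‖ ^ 2 := pow_pos (hδ.trans_le hx) 2
  rw [mul_truncInv_apply, max_eq_left (by gcongr), div_self hpos.ne', Complex.ofReal_one, sub_self]

theorem norm_one_sub_mul_truncInv_apply_le (f : C₀(X, ℂ)) {δ : ℝ} (hδ : 0 < δ) (x : X) :
    ‖1 - (f * truncInv f hδ) x‖ ≤ 1 := by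
  have hmax : 0 < max (‖f x‖ ^ 2) (δ ^ 2) := lt_max_of_lt_right (pow_pos hδ 2)
  have hle : ‖f x‖ ^ 2 / max (‖f x‖ ^ 2) (δ ^ 2) ≤ 1 := (div_le_one hmax).2 (le_max_left _ _)
  rw [mul_truncInv_apply, ← Complex.ofReal_one, ← Complex.ofReal_sub, Complex.norm_real,
    Real.norm_of_nonneg (sub_nonneg.2 hle)]
  exact sub_le_self _ (by positivity)

theorem norm_sub_mul_truncInv_mul_le (f : C₀(X, ℂ)) {δ : ℝ} (hδ : 0 < δ) :
    ‖f - f * truncInv f hδ * f‖ ≤ δ := by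
  refine (zeroAtInfty_norm_le hδ.le).2 fun x => ?_
  have hfactor : (f - f * truncInv f hδ * f) x = (1 - (f * truncInv f hδ) x) * f x :=
    (one_sub_mul _ _).symm
  rw [hfactor]
  rcases le_or_gt δ ‖f x‖ with hx | hx
  · rw [one_sub_mul_truncInv_apply_of_le f hδ hx, zero_mul, norm_zero]
    exact hδ.le
  · rw [norm_mul]
    exact (mul_le_of_le_one_left (norm_nonneg _)
      (norm_one_sub_mul_truncInv_apply_le f hδ x)).trans hx.le

theorem mem_closure_range_mul_self (g : C₀(X, ℂ)) :
    g ∈ closure (Set.range fun e : C₀(X, ℂ) => e * g) :=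
  Metric.mem_closure_iff.2 fun ε hε => ⟨_, ⟨g * truncInv g (half_pos hε), rfl⟩, by
    rw [dist_eq_norm]
    exact (norm_sub_mul_truncInv_mul_le g (half_pos hε)).trans_lt (half_lt_self hε)⟩

theorem map_mem_of_forall_map_mul_mem {E : Type*} [TopologicalSpace E] {φ : C₀(X, ℂ) → E}
    (hφ : Continuous φ) {C : Set E} (hC : IsClosed C) {g : C₀(X, ℂ)} (h : ∀ e, φ (e * g) ∈ C) :
    φ g ∈ C :=
  hC.closure_subset <| map_mem_closure hφ (mem_closure_range_mul_self g) <| by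
    rintro _ ⟨e, rfl⟩
    exact h e

/-- The ideal `I_F` of the functions in `C₀(X)` vanishing on `F`. -/
def vanishingIdeal (F : Set X) : Submodule ℂ C₀(X, ℂ) where
  carrier := {f | ∀ x ∈ F, f x = 0}
  add_mem' hf hg x hx := by simp [hf x hx, hg x hx]
  zero_mem' _ _ := rfl
  smul_mem' c f hf x hx := by simp [hf x hx]

section Ideal

variable {I : Submodule ℂ C₀(X, ℂ)}

theorem exists_mem_le_norm_of_isCompact (hmul : ∀ f, ∀ g ∈ I, f * g ∈ I)
    {K : Set X} (hK : IsCompact K) (hKI : ∀ x ∈ K, ∃ g ∈ I, g x ≠ 0) :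
    ∃ G ∈ I, ∃ c > 0, ∀ x ∈ K, c ≤ ‖G x‖ := by
  choose! g hgI hg using hKI
  obtain ⟨t, htK, ht⟩ := hK.elim_nhds_subcover (fun x => {y | g x y ≠ 0}) fun x hx =>
    (isOpen_ne_fun (g x).continuous continuous_const).mem_nhds (hg x hx)
  let G : C₀(X, ℂ) := ∑ x ∈ t, star (g x) * g x
  have hG : ∀ y, G y = (∑ x ∈ t, ‖g x y‖ ^ 2 : ℝ) := fun y => by
    simp [G, zeroAtInfty_sum_apply, Complex.conj_mul']
  have hpos : ∀ y ∈ K, 0 < ‖G y‖ := fun y hy => by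
    obtain ⟨x, hxt, hxy⟩ := Set.mem_iUnion₂.1 (ht hy)
    rw [hG, Complex.norm_real, Real.norm_of_nonneg (by positivity)]
    exact Finset.sum_pos' (fun _ _ => sq_nonneg _)
      ⟨x, hxt, pow_pos (norm_pos_iff.2 hxy) 2⟩
  exact ⟨G, Submodule.sum_mem _ fun x hx => hmul _ _ (hgI x (htK x hx)),
    hK.exists_forall_le' G.continuous.norm.continuousOn hpos⟩

theorem exists_mem_norm_sub_le (hmul : ∀ f, ∀ g ∈ I, f * g ∈ I) {f : C₀(X, ℂ)}
    {ε : ℝ} (hε : 0 < ε) (hf : ∀ x, (∀ g ∈ I, g x = 0) → ‖f x‖ < ε) :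
    ∃ h ∈ I, ‖f - h‖ ≤ ε := by
  obtain ⟨G, hGI, c, hc, hcG⟩ := exists_mem_le_norm_of_isCompact hmul
    (isCompact_setOf_le_norm f hε) fun x hx => by
      contrapose! hx
      simpa using hf x hx
  refine ⟨f * truncInv G hc * G, hmul _ _ hGI, (zeroAtInfty_norm_le hε.le).2 fun x => ?_⟩
  have hfactor : (f - f * truncInv G hc * G) x = f x * (1 - (G * truncInv G hc) x) := by
    simp only [ZeroAtInftyContinuousMap.sub_apply, ZeroAtInftyContinuousMap.mul_apply]
    ring
  rw [hfactor]
  rcases le_or_gt ε ‖f x‖ with hx | hx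
  · rw [one_sub_mul_truncInv_apply_of_le G hc (hcG x hx), mul_zero, norm_zero]
    exact hε.le
  · rw [norm_mul]
    exact (mul_le_of_le_one_right (norm_nonneg _)
      (norm_one_sub_mul_truncInv_apply_le G hc x)).trans hx.le

theorem mem_of_forall_common_zero (hmul : ∀ f, ∀ g ∈ I, f * g ∈ I)
    (hI : IsClosed (I : Set C₀(X, ℂ))) {f : C₀(X, ℂ)}
    (hf : ∀ x, (∀ g ∈ I, g x = 0) → f x = 0) : f ∈ I := by
  refine hI.closure_subset <| Metric.mem_closure_iff.2 fun ε hε => ?_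
  obtain ⟨h, hh, hfh⟩ := exists_mem_norm_sub_le hmul (f := f) (half_pos hε) fun x hx => by
    simpa [hf x hx] using hε
  exact ⟨h, hh, by rw [dist_eq_norm]; linarith⟩

end Ideal

theorem exists_mem_vanishingIdeal_apply_eq_one [LocallyCompactSpace X] [T2Space X]
    {F : Set X} (hF : IsClosed F) {x : X} (hx : x ∉ F) : ∃ f ∈ vanishingIdeal F, f x = 1 := by
  obtain ⟨f, hf₁, hf₀, hf, -⟩ := exists_continuous_one_zero_of_isCompact
    (isCompact_singleton (x := x)) hF (Set.disjoint_singleton_left.2 hx)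
  refine ⟨⟨⟨fun y => (f y : ℂ), by fun_prop⟩,
    (hf.comp_left (g := Complex.ofReal) Complex.ofReal_zero).is_zero_at_infty⟩, fun y hy => ?_, ?_⟩
  · exact congrArg Complex.ofReal (hf₀ hy)
  · exact congrArg Complex.ofReal (hf₁ rfl)

theorem subset_of_vanishingIdeal_le [LocallyCompactSpace X] [T2Space X]
    {F G : Set X} (hG : IsClosed G) (h : vanishingIdeal G ≤ vanishingIdeal F) : F ⊆ G := by
  intro x hx
  by_contra hxG
  obtain ⟨f, hf, hfx⟩ := exists_mem_vanishingIdeal_apply_eq_one hG hxG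
  exact one_ne_zero (hfx.symm.trans (h hf x hx))

theorem vanishingIdeal_inj [LocallyCompactSpace X] [T2Space X]
    {F G : Set X} (hF : IsClosed F) (hG : IsClosed G) :
    vanishingIdeal F = vanishingIdeal G ↔ F = G :=
  ⟨fun h => (subset_of_vanishingIdeal_le hG h.ge).antisymm (subset_of_vanishingIdeal_le hF h.le),
    fun h => h ▸ rfl⟩

end ZeroAtInfty

/-! ### Matrices of operators -/

section Amplification

open scoped InnerProductSpace Matrix.Norms.L2Operator

theorem opNorm_le_of_norm_inner_le {𝕜 E F : Type*} [RCLike 𝕜] [NormedAddCommGroup E]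
    [InnerProductSpace 𝕜 E] [NormedAddCommGroup F] [InnerProductSpace 𝕜 F] {A : E →L[𝕜] F}
    {C : ℝ} (hC : 0 ≤ C) (h : ∀ y x, ‖⟪y, A x⟫_𝕜‖ ≤ C * ‖y‖ * ‖x‖) : ‖A‖ ≤ C :=
  A.opNorm_le_of_re_inner_le hC fun x y hx hy => by
    simpa only [norm_inner_symm (𝕜 := 𝕜), hx, hy, mul_one] using
      (RCLike.re_le_norm ⟪A x, y⟫_𝕜).trans ((norm_inner_symm _ _).trans_le (h y x))

theorem norm_inner_apply_le {𝕜 E F : Type*} [RCLike 𝕜] [NormedAddCommGroup E]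
    [InnerProductSpace 𝕜 E] [NormedAddCommGroup F] [InnerProductSpace 𝕜 F] {A : E →L[𝕜] F}
    {C : ℝ} (hA : ‖A‖ ≤ C) (y : F) (x : E) : ‖⟪y, A x⟫_𝕜‖ ≤ C * ‖y‖ * ‖x‖ :=
  calc ‖⟪y, A x⟫_𝕜‖ ≤ ‖y‖ * ‖A x‖ := norm_inner_le_norm _ _
    _ ≤ ‖y‖ * (C * ‖x‖) := by gcongr; exact A.le_of_opNorm_le hA x
    _ = C * ‖y‖ * ‖x‖ := by ring

variable {ι : Type*} [Fintype ι] {H : Type*} [NormedAddCommGroup H] [InnerProductSpace ℂ H]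

/-- The operator on the Hilbert sum `H^ι` given by a matrix of operators on `H`; this is `matrixOp`
for an arbitrary finite index type. -/
noncomputable def blockOp (a : Matrix ι ι (H →L[ℂ] H)) :
    PiLp 2 (fun _ : ι => H) →L[ℂ] PiLp 2 (fun _ : ι => H) :=
  (PiLp.continuousLinearEquiv 2 ℂ (fun _ : ι => H)).symm.toContinuousLinearMap ∘L
    (ContinuousLinearMap.pi fun i => ∑ j, a i j ∘L ContinuousLinearMap.proj j) ∘L
    (PiLp.continuousLinearEquiv 2 ℂ (fun _ : ι => H)).toContinuousLinearMap

theorem blockOp_apply (a : Matrix ι ι (H →L[ℂ] H)) (h : PiLp 2 (fun _ : ι => H)) (i : ι) :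
    blockOp a h i = ∑ j, a i j (h j) := by
  simp [blockOp]

theorem inner_blockOp (a : Matrix ι ι (H →L[ℂ] H)) (k h : PiLp 2 (fun _ : ι => H)) :
    ⟪k, blockOp a h⟫_ℂ = ∑ i, ∑ j, ⟪k i, a i j (h j)⟫_ℂ := by
  simp [PiLp.inner_apply, blockOp_apply, inner_sum]

theorem norm_blockOp_le_of_tendsto {κ : Type*} {l : Filter κ} [l.NeBot]
    {a : κ → Matrix ι ι (H →L[ℂ] H)} {b : Matrix ι ι (H →L[ℂ] H)} {C : ℝ} (hC : 0 ≤ C)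
    (hab : ∀ i j, Filter.Tendsto (fun t => a t i j) l (nhds (b i j)))
    (ha : ∀ᶠ t in l, ‖blockOp (a t)‖ ≤ C) : ‖blockOp b‖ ≤ C := by
  refine opNorm_le_of_norm_inner_le hC fun k h => ?_
  have hlim : Filter.Tendsto (fun t => ⟪k, blockOp (a t) h⟫_ℂ) l (nhds ⟪k, blockOp b h⟫_ℂ) := by
    simp only [inner_blockOp]
    exact tendsto_finsetSum _ fun i _ => tendsto_finsetSum _ fun j _ =>
      tendsto_const_nhds.inner <|
        ((ContinuousLinearMap.apply ℂ H (h j)).continuous.tendsto (b i j)).comp (hab i j)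
  exact le_of_tendsto hlim.norm (ha.mono fun t ht => norm_inner_apply_le ht k h)

variable [DecidableEq ι] {X : Type*} [TopologicalSpace X]

/-- The `(p, q)` entry of a matrix-valued function of `C₀(X)`, as a scalar function. -/
noncomputable def entry (M : C₀(X, Matrix ι ι ℂ)) (p q : ι) : C₀(X, ℂ) where
  toFun x := M x p q
  continuous_toFun := M.continuous.matrix_elem p q
  zero_at_infty' :=
    ((continuous_id.matrix_elem p q).tendsto (0 : Matrix ι ι ℂ)).comp M.zero_at_infty'

theorem entry_mul (M N : C₀(X, Matrix ι ι ℂ)) (p q : ι) :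
    entry (M * N) p q = ∑ r, entry M p r * entry N r q := by
  ext x
  rw [zeroAtInfty_sum_apply]
  exact Matrix.mul_apply

/-- The matrix-valued function of `C₀(X)` with given scalar entries. -/
noncomputable def ofEntries (f : Matrix ι ι C₀(X, ℂ)) : C₀(X, Matrix ι ι ℂ) where
  toFun x := f.map fun g => g x
  continuous_toFun := continuous_matrix fun i j => (f i j).continuous
  zero_at_infty' := tendsto_pi_nhds.2 fun i => tendsto_pi_nhds.2 fun j => (f i j).zero_at_infty'

variable [CompleteSpace H] (π : C₀(X, ℂ) →⋆ₙₐ[ℂ] (H →L[ℂ] H))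

/-- The representation of `C₀(X, M_ι(ℂ))` on `H^ι` obtained by applying a representation `π` of
`C₀(X)` entrywise. -/
noncomputable def amplification :
    C₀(X, Matrix ι ι ℂ) →⋆ₙₐ[ℂ] (PiLp 2 (fun _ : ι => H) →L[ℂ] PiLp 2 (fun _ : ι => H)) where
  toFun M := blockOp (Matrix.of fun p q => π (entry M p q))
  map_smul' c M := by
    ext h i
    have hentry : ∀ p q, entry (c • M) p q = c • entry M p q := fun p q => rfl
    simp [blockOp_apply, hentry, Finset.smul_sum]
  map_zero' := by
    ext h i
    have hentry : ∀ p q, entry (0 : C₀(X, Matrix ι ι ℂ)) p q = 0 := fun p q => rfl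
    simp [blockOp_apply, hentry]
  map_add' M N := by
    ext h i
    have hentry : ∀ p q, entry (M + N) p q = entry M p q + entry N p q := fun p q => rfl
    simp [blockOp_apply, hentry, Finset.sum_add_distrib]
  map_mul' M N := by
    ext h i
    simp only [blockOp_apply, Matrix.of_apply, entry_mul, map_sum, map_mul, mul_apply_eq_comp,
      sum_apply]
    rw [Finset.sum_comm]
  map_star' M := by
    rw [ContinuousLinearMap.star_eq_adjoint, ContinuousLinearMap.eq_adjoint_iff]
    intro x y
    have hentry : ∀ p q, entry (star M) p q = star (entry M q p) := fun p q => rfl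
    simp only [PiLp.inner_apply, blockOp_apply, Matrix.of_apply, hentry, map_star, sum_inner,
      inner_sum, ContinuousLinearMap.star_eq_adjoint, ContinuousLinearMap.adjoint_inner_left]
    rw [Finset.sum_comm]

theorem norm_blockOp_map_le {f : Matrix ι ι C₀(X, ℂ)} {C : ℝ} (hC : 0 ≤ C)
    (hf : ∀ x, ‖f.map fun g => g x‖ ≤ C) : ‖blockOp (f.map π)‖ ≤ C :=
  (NonUnitalStarAlgHom.norm_apply_le (amplification π) (ofEntries f)).trans
    ((zeroAtInfty_norm_le hC).2 hf)

theorem matrix_norm_le_of_norm_sum_le {A : Matrix ι ι ℂ} {C : ℝ} (hC : 0 ≤ C)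
    (h : ∀ a b : EuclideanSpace ℂ ι, ‖∑ i, ∑ j, star (a i) * A i j * b j‖ ≤ C * ‖a‖ * ‖b‖) :
    ‖A‖ ≤ C := by
  rw [Matrix.l2_opNorm_def]
  refine opNorm_le_of_norm_inner_le hC fun y x => ?_
  refine le_of_eq_of_le (congrArg norm ?_) (h y x)
  simp [PiLp.inner_apply, Matrix.toLpLin_apply, Matrix.mulVec, dotProduct, Finset.mul_sum,
    mul_comm, mul_left_comm, mul_assoc]

end Amplification

/-! ### Words -/

namespace MultiSystem

variable {n : ℕ} {X : Type u} [TopologicalSpace X]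

/-- The composition `σ_w = σ_{i_1} ⋯ σ_{i_k}` along a word. -/
def act (S : MultiSystem n X) : List (Fin n) → X → X
  | [], x => x
  | i :: w, x => S.map i (S.act w x)

/-- The function `f ∘ σ_w` of `C₀(X)`. -/
noncomputable def pullWord (S : MultiSystem n X) : List (Fin n) → C₀(X, ℂ) → C₀(X, ℂ)
  | [], f => f
  | i :: w, f => S.pullWord w (S.pull i f)

theorem pullWord_apply (S : MultiSystem n X) (w : List (Fin n)) (f : C₀(X, ℂ)) (x : X) :
    S.pullWord w f x = f (S.act w x) := by
  induction w generalizing f with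
  | nil => rfl
  | cons i _ ih => exact ih _

/-- Freeness of the system: the maps are injective with pairwise disjoint ranges, as those of
the covering system are. -/
def IsFree (S : MultiSystem n X) : Prop :=
  ∀ (i j : Fin n) (x y : X), S.map i x = S.map j y → i = j ∧ x = y

theorem IsFree.act_inj {S : MultiSystem n X} (hS : S.IsFree) {v w : List (Fin n)} {x y : X}
    (hl : v.length = w.length) (h : S.act v x = S.act w y) : v = w ∧ x = y := by
  induction v generalizing w with
  | nil =>
    obtain rfl : w = [] := List.length_eq_zero_iff.1 hl.symm
    exact ⟨rfl, h⟩
  | cons i v ih =>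
    obtain ⟨j, w, rfl⟩ := List.exists_cons_of_length_eq_add_one hl.symm
    obtain ⟨rfl, hvw⟩ := hS _ _ _ _ h
    obtain ⟨rfl, hxy⟩ := ih (Nat.succ_injective hl) hvw
    exact ⟨rfl, hxy⟩

end MultiSystem

section Words

/-- The words of length `k` in `1, …, n`. -/
def wordsOfLength (n : ℕ) : ℕ → Finset (List (Fin n))
  | 0 => {[]}
  | k + 1 => (Finset.univ ×ˢ wordsOfLength n k).image fun p => p.1 :: p.2

theorem mem_wordsOfLength {n k : ℕ} {v : List (Fin n)} :
    v ∈ wordsOfLength n k ↔ v.length = k := by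
  induction k generalizing v with
  | zero => simp [wordsOfLength]
  | succ k ih => cases v <;> simp [wordsOfLength, ih]

theorem sum_wordsOfLength_succ {n k : ℕ} {M : Type*} [AddCommMonoid M] (g : List (Fin n) → M) :
    ∑ v ∈ wordsOfLength n (k + 1), g v = ∑ i, ∑ v ∈ wordsOfLength n k, g (i :: v) := by
  rw [wordsOfLength, Finset.sum_image, Finset.sum_product]
  rintro ⟨i, v⟩ _ ⟨j, w⟩ _ h
  simpa using h

/-- The words of length less than `N` in `1, …, n`. -/
def wordsOfLengthLT (n N : ℕ) : Finset (List (Fin n)) :=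
  (Finset.range N).biUnion (wordsOfLength n)

theorem mem_wordsOfLengthLT {n N : ℕ} {v : List (Fin n)} :
    v ∈ wordsOfLengthLT n N ↔ v.length < N := by
  simp [wordsOfLengthLT, mem_wordsOfLength]

theorem sum_wordsOfLengthLT {n N : ℕ} {M : Type*} [AddCommMonoid M] (g : List (Fin n) → M) :
    ∑ v ∈ wordsOfLengthLT n N, g v = ∑ k ∈ Finset.range N, ∑ v ∈ wordsOfLength n k, g v :=
  Finset.sum_biUnion fun _ _ _ _ hkl => Finset.disjoint_left.2 fun _ hk hl =>
    hkl ((mem_wordsOfLength.1 hk).symm.trans (mem_wordsOfLength.1 hl))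

end Words

namespace RowContractiveRep

variable {n : ℕ} {X : Type u} [TopologicalSpace X] {S : MultiSystem n X}
variable {H : Type u} [NormedAddCommGroup H] [InnerProductSpace ℂ H] [CompleteSpace H]
variable (ρ : RowContractiveRep S H)

@[simp]
theorem word_nil : ρ.word [] = 1 := rfl

@[simp]
theorem word_cons (i : Fin n) (w : List (Fin n)) : ρ.word (i :: w) = ρ.T i * ρ.word w :=
  List.prod_cons

theorem word_append (v w : List (Fin n)) : ρ.word (v ++ w) = ρ.word v * ρ.word w := by
  simp [word]

theorem π_mul_word (f : C₀(X, ℂ)) (w : List (Fin n)) :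
    ρ.π f * ρ.word w = ρ.word w * ρ.π (S.pullWord w f) := by
  induction w generalizing f with
  | nil => simp [MultiSystem.pullWord]
  | cons i w ih =>
    rw [word_cons, ← mul_assoc, ρ.covariant, mul_assoc, ih, ← mul_assoc, MultiSystem.pullWord]

theorem eval_single (w : List (Fin n)) (f : C₀(X, ℂ)) :
    ρ.eval (Finsupp.single w f) = ρ.word w * ρ.π f := by
  simp [eval]

theorem eval_apply (a : CovAlg n X) (x : H) :
    ρ.eval a x = ∑ w ∈ a.support, ρ.word w (ρ.π (a w) x) := by
  rw [eval, Finsupp.sum, sum_apply]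
  rfl

end RowContractiveRep

/-! ### The shift representation of a free system -/

section ShiftRep

open scoped InnerProductSpace lp

variable {n : ℕ} {X : Type u} [TopologicalSpace X] {S : MultiSystem n X}

open Classical in
/-- The canonical basis vector `e_p` of `ℓ²(P)`. -/
noncomputable def basisVector {P : Type*} (p : P) : ℓ²(P, ℂ) := lp.single 2 p 1

theorem basisVector_eq_single {P : Type*} [DecidableEq P] (p : P) :
    basisVector p = (lp.single 2 p 1 : ℓ²(P, ℂ)) := by
  rw [basisVector]
  congr!

theorem basisVector_apply {P : Type*} [DecidableEq P] (p q : P) :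
    basisVector p q = if p = q then 1 else 0 := by
  simp [basisVector_eq_single, lp.single_apply, Pi.single_apply, eq_comm]

theorem inner_basisVector {P : Type*} (p : P) (ξ : ℓ²(P, ℂ)) : ⟪basisVector p, ξ⟫_ℂ = ξ p := by
  simp [basisVector, lp.inner_single_left]

/-- Multiplication operators `f ↦ M_f` as a representation of `C₀(X)` on `ℓ²(X × ℤ)`. -/
noncomputable def shiftMul (X : Type u) [TopologicalSpace X] :
    C₀(X, ℂ) →⋆ₙₐ[ℂ] (ℓ²(X × ℤ, ℂ) →L[ℂ] ℓ²(X × ℤ, ℂ)) where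
  toFun f := lp.mapCLM 2 (fun p => f p.1 • ContinuousLinearMap.id ℂ ℂ) (norm_nonneg f) fun p => by
    simpa [norm_smul] using zeroAtInfty_norm_apply_le f p.1
  map_smul' c f := by
    ext ξ p
    exact mul_assoc c (f p.1) (ξ p)
  map_zero' := by
    ext ξ p
    exact zero_mul (ξ p)
  map_add' f g := by
    ext ξ p
    exact add_mul (f p.1) (g p.1) (ξ p)
  map_mul' f g := by
    ext ξ p
    exact mul_assoc (f p.1) (g p.1) (ξ p)
  map_star' f := by
    rw [ContinuousLinearMap.star_eq_adjoint, ContinuousLinearMap.eq_adjoint_iff]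
    intro ξ η
    rw [lp.inner_eq_tsum, lp.inner_eq_tsum]
    refine tsum_congr fun p => ?_
    change η p * star (star (f p.1) * ξ p) = f p.1 * η p * star (ξ p)
    rw [star_mul, star_star]
    ring

theorem shiftMul_apply (f : C₀(X, ℂ)) (ξ : ℓ²(X × ℤ, ℂ)) (p : X × ℤ) :
    shiftMul X f ξ p = f p.1 * ξ p := rfl

theorem shiftMul_basisVector (f : C₀(X, ℂ)) (p : X × ℤ) :
    shiftMul X f (basisVector p) = f p.1 • basisVector p := by
  classical
  ext q
  by_cases hpq : p = q <;> simp [shiftMul_apply, basisVector_apply, hpq]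

theorem norm_shiftMul (f : C₀(X, ℂ)) : ‖shiftMul X f‖ = ‖f‖ := by
  classical
  refine le_antisymm (NonUnitalStarAlgHom.norm_apply_le _ f)
    ((zeroAtInfty_norm_le (norm_nonneg _)).2 fun x => ?_)
  have hle := (shiftMul X f).le_opNorm (basisVector (x, 0))
  rwa [shiftMul_basisVector, norm_smul, basisVector_eq_single, lp.norm_single (by norm_num),
    norm_one, mul_one, mul_one] at hle

theorem MultiSystem.IsFree.shift_eq_iff (hS : S.IsFree) {i j : Fin n} {p q : X × ℤ} :
    (S.map i p.1, p.2 + 1) = (S.map j q.1, q.2 + 1) ↔ i = j ∧ p = q := by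
  refine ⟨fun h => ?_, by rintro ⟨rfl, rfl⟩; rfl⟩
  obtain ⟨hx, hk⟩ := Prod.mk.inj h
  exact ⟨(hS _ _ _ _ hx).1, Prod.ext (hS _ _ _ _ hx).2 (add_right_cancel hk)⟩

theorem MultiSystem.IsFree.orthonormal_shift (hS : S.IsFree) (i : Fin n) :
    Orthonormal ℂ fun p : X × ℤ => basisVector (S.map i p.1, p.2 + 1) := by
  classical
  refine orthonormal_iff_ite.2 fun p q => ?_
  simp only [inner_basisVector, basisVector_apply, hS.shift_eq_iff, true_and, eq_comm]

/-- The isometry `e_{x,k} ↦ e_{σ_i x, k+1}` of `ℓ²(X × ℤ)`. -/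
noncomputable def shift (hS : S.IsFree) (i : Fin n) : ℓ²(X × ℤ, ℂ) →L[ℂ] ℓ²(X × ℤ, ℂ) :=
  (hS.orthonormal_shift i).orthogonalFamily.linearIsometry.toContinuousLinearMap

theorem shift_basisVector (hS : S.IsFree) (i : Fin n) (p : X × ℤ) :
    shift hS i (basisVector p) = basisVector (S.map i p.1, p.2 + 1) := by
  classical
  rw [basisVector_eq_single]
  exact ((hS.orthonormal_shift i).orthogonalFamily.linearIsometry_apply_single 1).trans
    (one_smul ℂ _)

theorem star_shift_apply (hS : S.IsFree) (i : Fin n) (ξ : ℓ²(X × ℤ, ℂ)) (p : X × ℤ) :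
    star (shift hS i) ξ p = ξ (S.map i p.1, p.2 + 1) := by
  rw [← inner_basisVector, ContinuousLinearMap.star_eq_adjoint,
    ContinuousLinearMap.adjoint_inner_right, shift_basisVector, inner_basisVector]

theorem shift_apply (hS : S.IsFree) (i j : Fin n) (ξ : ℓ²(X × ℤ, ℂ)) (p : X × ℤ) :
    shift hS i ξ (S.map j p.1, p.2 + 1) = if i = j then ξ p else 0 := by
  classical
  have hadj : star (shift hS i) (basisVector (S.map j p.1, p.2 + 1)) =
      if i = j then basisVector p else 0 := by
    ext q
    rw [star_shift_apply]
    split_ifs with hij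
    · simp [basisVector_apply, hS.shift_eq_iff, hij]
    · simp [basisVector_apply, hS.shift_eq_iff, Ne.symm hij]
  rw [← inner_basisVector, ← ContinuousLinearMap.adjoint_inner_left,
    ← ContinuousLinearMap.star_eq_adjoint, hadj]
  split_ifs <;> simp [inner_basisVector]

theorem star_shift_mul_shift (hS : S.IsFree) (i j : Fin n) :
    star (shift hS i) * shift hS j = if i = j then 1 else 0 := by
  ext ξ p
  rw [mul_apply_eq_comp, star_shift_apply, shift_apply]
  by_cases hij : i = j
  · simp [hij]
  · rw [if_neg (Ne.symm hij), if_neg hij]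
    rfl

theorem sum_shift_mul_star_shift (hS : S.IsFree) (hsurj : S.IsSurjective) :
    ∑ i, shift hS i * star (shift hS i) = 1 := by
  ext ξ ⟨x, k⟩
  obtain ⟨j, y, rfl⟩ := hsurj x
  obtain ⟨l, rfl⟩ : ∃ l, k = l + 1 := ⟨k - 1, (sub_add_cancel k 1).symm⟩
  rw [sum_apply, lp.coeFn_sum, Finset.sum_apply]
  simp only [mul_apply_eq_comp, shift_apply hS _ j _ (y, l)]
  simp [star_shift_apply]

theorem norm_sum_shift_sq (hS : S.IsFree) (h : Fin n → ℓ²(X × ℤ, ℂ)) :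
    ‖∑ i, shift hS i (h i)‖ ^ 2 = ∑ i, ‖h i‖ ^ 2 := by
  have horth : OrthogonalFamily ℂ (fun _ : Fin n => ℓ²(X × ℤ, ℂ))
      fun i => (hS.orthonormal_shift i).orthogonalFamily.linearIsometry := fun i j hij v w => by
    change ⟪shift hS i v, shift hS j w⟫_ℂ = 0
    rw [← ContinuousLinearMap.adjoint_inner_right, ← ContinuousLinearMap.star_eq_adjoint,
      ← mul_apply_eq_comp, star_shift_mul_shift, if_neg hij, zero_apply, inner_zero_right]
  exact horth.norm_sum h Finset.univ

theorem shiftMul_mul_shift (hS : S.IsFree) (f : C₀(X, ℂ)) (i : Fin n) :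
    shiftMul X f * shift hS i = shift hS i * shiftMul X (S.pull i f) := by
  have hstar : star (shift hS i) * shiftMul X (star f) =
      shiftMul X (star (S.pull i f)) * star (shift hS i) := by
    ext ξ p
    simp only [mul_apply_eq_comp, star_shift_apply, shiftMul_apply]
    rfl
  simpa only [star_mul, map_star, star_star] using congrArg star hstar

/-- The representation of a free system on `ℓ²(X × ℤ)` by multiplication operators and the shifts
`e_{x,k} ↦ e_{σ_i x, k+1}`. The coordinate in `ℤ` makes words of different lengths act with
orthogonal ranges even at periodic points. -/
noncomputable def shiftRep (hS : S.IsFree) : RowContractiveRep S ℓ²(X × ℤ, ℂ) where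
  π := shiftMul X
  T := shift hS
  covariant := shiftMul_mul_shift hS
  row_contractive h := (norm_sum_shift_sq hS h).le

end ShiftRep

/-! ### Defect operators of row contractions -/

namespace RowContractiveRep

open scoped InnerProductSpace

variable {n : ℕ} {X : Type u} [TopologicalSpace X] {S : MultiSystem n X}
variable {H : Type u} [NormedAddCommGroup H] [InnerProductSpace ℂ H] [CompleteSpace H]
variable (ρ : RowContractiveRep S H)

/-- The completely positive map `A ↦ ∑ T_i A T_i*` of a row contraction. -/
noncomputable def cp (A : H →L[ℂ] H) : H →L[ℂ] H := ∑ i, ρ.T i * A * star (ρ.T i)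

theorem cp_sub (A B : H →L[ℂ] H) : ρ.cp (A - B) = ρ.cp A - ρ.cp B := by
  simp [cp, mul_sub, sub_mul]

theorem cp_iterate_sub (A B : H →L[ℂ] H) (k : ℕ) :
    ρ.cp^[k] (A - B) = ρ.cp^[k] A - ρ.cp^[k] B :=
  Function.Semiconj₂.iterate ρ.cp_sub k A B

theorem cp_iterate_nonneg {A : H →L[ℂ] H} (hA : 0 ≤ A) (k : ℕ) : 0 ≤ ρ.cp^[k] A := by
  induction k with
  | zero => exact hA
  | succ k ih =>
    rw [Function.iterate_succ_apply']
    exact Finset.sum_nonneg fun i _ => star_right_conjugate_nonneg ih _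

theorem sum_wordsOfLength_conj (A : H →L[ℂ] H) (k : ℕ) :
    ∑ v ∈ wordsOfLength n k, ρ.word v * A * star (ρ.word v) = ρ.cp^[k] A := by
  induction k with
  | zero => simp [wordsOfLength]
  | succ k ih =>
    rw [sum_wordsOfLength_succ, Function.iterate_succ_apply', ← ih, cp]
    simp [Finset.mul_sum, Finset.sum_mul, mul_assoc]

theorem re_inner_cp_one (h : H) : (⟪h, ρ.cp 1 h⟫_ℂ).re = ∑ i, ‖star (ρ.T i) h‖ ^ 2 := by
  have hterm : ∀ i, (⟪h, ρ.T i (star (ρ.T i) h)⟫_ℂ).re = ‖star (ρ.T i) h‖ ^ 2 := fun i => by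
    rw [← ContinuousLinearMap.adjoint_inner_left, ← ContinuousLinearMap.star_eq_adjoint]
    exact inner_self_eq_norm_sq (𝕜 := ℂ) _
  simp only [cp, mul_one, sum_apply, mul_apply_eq_comp, inner_sum, Complex.re_sum, hterm]

theorem norm_cp_one_apply_sq_le (h : H) : ‖ρ.cp 1 h‖ ^ 2 ≤ (⟪h, ρ.cp 1 h⟫_ℂ).re := by
  rw [re_inner_cp_one]
  simpa [cp] using ρ.row_contractive fun i => star (ρ.T i) h

theorem norm_cp_one_le : ‖ρ.cp 1‖ ≤ 1 := by
  refine ContinuousLinearMap.opNorm_le_bound _ zero_le_one fun h => ?_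
  have hsq : ‖ρ.cp 1 h‖ ^ 2 ≤ ‖h‖ * ‖ρ.cp 1 h‖ :=
    (ρ.norm_cp_one_apply_sq_le h).trans ((Complex.re_le_norm _).trans (norm_inner_le_norm _ _))
  nlinarith [norm_nonneg h, norm_nonneg (ρ.cp 1 h)]

theorem norm_cp_one_apply_le (h : H) : ‖ρ.cp 1 h‖ ≤ ‖h‖ :=
  (ρ.cp 1).le_of_opNorm_le_of_le ρ.norm_cp_one_le le_rfl |>.trans_eq (one_mul _)

theorem sum_norm_star_sq_le (h : H) : ∑ i, ‖star (ρ.T i) h‖ ^ 2 ≤ ‖h‖ ^ 2 :=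
  calc ∑ i, ‖star (ρ.T i) h‖ ^ 2 = (⟪h, ρ.cp 1 h⟫_ℂ).re := (ρ.re_inner_cp_one h).symm
    _ ≤ ‖h‖ * ‖ρ.cp 1 h‖ := (Complex.re_le_norm _).trans (norm_inner_le_norm _ _)
    _ ≤ ‖h‖ * ‖h‖ := by gcongr; exact ρ.norm_cp_one_apply_le h
    _ = ‖h‖ ^ 2 := (sq _).symm

theorem one_sub_cp_one_nonneg : 0 ≤ 1 - ρ.cp 1 :=
  sub_nonneg.2 <| (CStarAlgebra.norm_le_one_iff_of_nonneg _
    (ρ.cp_iterate_nonneg zero_le_one 1)).1 ρ.norm_cp_one_le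

/-- The defect operator `(1 - ∑ T_i T_i*)^{1/2}`. -/
noncomputable def defect : H →L[ℂ] H := CFC.sqrt (1 - ρ.cp 1)

theorem defect_mul_self : ρ.defect * ρ.defect = 1 - ρ.cp 1 :=
  CFC.sqrt_mul_sqrt_self _ ρ.one_sub_cp_one_nonneg

theorem star_defect : star ρ.defect = ρ.defect :=
  (IsSelfAdjoint.of_nonneg (CFC.sqrt_nonneg _)).star_eq

theorem star_T_mul_π (f : C₀(X, ℂ)) (i : Fin n) :
    star (ρ.T i) * ρ.π f = ρ.π (S.pull i f) * star (ρ.T i) := by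
  have hpull : S.pull i (star f) = star (S.pull i f) := rfl
  simpa [hpull, map_star] using congrArg star (ρ.covariant (star f) i)

theorem commute_cp_one (f : C₀(X, ℂ)) : Commute (ρ.cp 1) (ρ.π f) := by
  rw [Commute, SemiconjBy, cp, Finset.sum_mul, Finset.mul_sum]
  refine Finset.sum_congr rfl fun i _ => ?_
  rw [mul_one, mul_assoc, star_T_mul_π, ← mul_assoc, ← ρ.covariant, mul_assoc]

theorem commute_defect (f : C₀(X, ℂ)) : Commute ρ.defect (ρ.π f) :=
  Commute.cfcₙ_nnreal ((Commute.one_left _).sub_left (ρ.commute_cp_one f)) _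

/-- The operator `∑_{v ∈ U} T_v D² T_v*`, where `D` is the defect operator. -/
noncomputable def defectSum (U : Finset (List (Fin n))) : H →L[ℂ] H :=
  ∑ v ∈ U, ρ.word v * (ρ.defect * ρ.defect) * star (ρ.word v)

theorem defectSum_wordsOfLengthLT (N : ℕ) :
    ρ.defectSum (wordsOfLengthLT n N) = 1 - ρ.cp^[N] 1 := by
  simp only [defectSum, sum_wordsOfLengthLT, sum_wordsOfLength_conj, defect_mul_self,
    cp_iterate_sub, ← Function.iterate_succ_apply]
  exact Finset.sum_range_sub' (fun k => ρ.cp^[k] 1) N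

theorem defectSum_mono : Monotone ρ.defectSum := fun _ _ hUW =>
  Finset.sum_le_sum_of_subset_of_nonneg hUW fun v _ _ => star_right_conjugate_nonneg
    (ρ.defect_mul_self ▸ ρ.one_sub_cp_one_nonneg) (ρ.word v)

theorem defectSum_le_one (U : Finset (List (Fin n))) : ρ.defectSum U ≤ 1 := by
  have hU : U ⊆ wordsOfLengthLT n (U.sup List.length + 1) := fun v hv =>
    mem_wordsOfLengthLT.2 (Nat.lt_succ_of_le (Finset.le_sup hv))
  refine (ρ.defectSum_mono hU).trans ?_
  rw [defectSum_wordsOfLengthLT]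
  exact sub_le_self _ (ρ.cp_iterate_nonneg zero_le_one _)

theorem norm_cp_iterate_one_le (N : ℕ) : ‖ρ.cp^[N] 1‖ ≤ 1 := by
  rw [CStarAlgebra.norm_le_one_iff_of_nonneg _ (ρ.cp_iterate_nonneg zero_le_one N),
    ← sub_nonneg, ← defectSum_wordsOfLengthLT, ← Finset.sum_empty]
  exact ρ.defectSum_mono (Finset.empty_subset _)

theorem sum_norm_defect_sq_le (U : Finset (List (Fin n))) (k : H) :
    ∑ v ∈ U, ‖ρ.defect (star (ρ.word v) k)‖ ^ 2 ≤ ‖k‖ ^ 2 := by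
  have hterm : ∀ v, ‖ρ.defect (star (ρ.word v) k)‖ ^ 2 =
      (⟪k, (ρ.word v * (ρ.defect * ρ.defect) * star (ρ.word v)) k⟫_ℂ).re := fun v => by
    rw [mul_apply_eq_comp, mul_apply_eq_comp, mul_apply_eq_comp,
      ← ContinuousLinearMap.adjoint_inner_left (ρ.word v), ← ContinuousLinearMap.star_eq_adjoint,
      ← ContinuousLinearMap.adjoint_inner_left ρ.defect, ← ContinuousLinearMap.star_eq_adjoint,
      star_defect]
    exact (inner_self_eq_norm_sq (𝕜 := ℂ) _).symm
  have hpos := (ContinuousLinearMap.le_def _ _).1 (ρ.defectSum_le_one U)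
  have hre := hpos.re_inner_nonneg_right k
  have hkk : (⟪k, k⟫_ℂ).re = ‖k‖ ^ 2 := inner_self_eq_norm_sq (𝕜 := ℂ) k
  simp only [sub_apply, inner_sub_right, one_apply_eq_self, defectSum, sum_apply, inner_sum,
    map_sub, map_sum, RCLike.re_to_complex, hkk, ← hterm] at hre
  exact sub_nonneg.1 hre

end RowContractiveRep

/-! ### The shift representation on orbits -/

section Fock

open scoped InnerProductSpace lp Matrix.Norms.L2Operator

variable {n : ℕ} {X : Type u} [TopologicalSpace X] {S : MultiSystem n X}

/-- The unit vector of `ℓ²(X × ℤ)` at the point `(σ_v x, |v|)` of the forward orbit of `x`. -/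
noncomputable def orbitVector (S : MultiSystem n X) (x : X) (v : List (Fin n)) : ℓ²(X × ℤ, ℂ) :=
  basisVector (S.act v x, (v.length : ℤ))

theorem MultiSystem.IsFree.orthonormal_orbitVector (hS : S.IsFree) (x : X) :
    Orthonormal ℂ (orbitVector S x) := by
  classical
  have hinj : ∀ v w, (S.act w x, (w.length : ℤ)) = (S.act v x, (v.length : ℤ)) ↔ v = w :=
    fun v w => ⟨fun h => (hS.act_inj (Nat.cast_injective (Prod.mk.inj h).2)
      (Prod.mk.inj h).1).1.symm, fun h => h ▸ rfl⟩
  refine orthonormal_iff_ite.2 fun v w => ?_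
  simp only [orbitVector, inner_basisVector, basisVector_apply, hinj]

theorem shiftRep_word_orbitVector (hS : S.IsFree) (x : X) (w v : List (Fin n)) :
    (shiftRep hS).word w (orbitVector S x v) = orbitVector S x (w ++ v) := by
  induction w with
  | nil => rfl
  | cons i w ih =>
    rw [RowContractiveRep.word_cons, mul_apply_eq_comp, ih]
    exact shift_basisVector hS i _

theorem shiftRep_eval_orbitVector (hS : S.IsFree) (a : CovAlg n X) (x : X) (v : List (Fin n)) :
    (shiftRep hS).eval a (orbitVector S x v) =
      ∑ w ∈ a.support, a w (S.act v x) • orbitVector S x (w ++ v) := by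
  rw [RowContractiveRep.eval_apply]
  refine Finset.sum_congr rfl fun w _ => ?_
  rw [← shiftRep_word_orbitVector hS, ← map_smul]
  exact congrArg _ (shiftMul_basisVector _ _)

/-- The function `x ↦ ⟪e_{σ_u x}, a e_{σ_v x}⟫`, that is, the matrix entry of `a` at the words `u`
and `v` in the orbit representation at `x`. -/
noncomputable def fockCoeff (S : MultiSystem n X) (a : CovAlg n X) (u v : List (Fin n)) :
    C₀(X, ℂ) :=
  ∑ w ∈ a.support, if u = w ++ v then S.pullWord v (a w) else 0

theorem fockCoeff_apply (hS : S.IsFree) (a : CovAlg n X) (u v : List (Fin n)) (x : X) :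
    fockCoeff S a u v x = ⟪orbitVector S x u, (shiftRep hS).eval a (orbitVector S x v)⟫_ℂ := by
  rw [shiftRep_eval_orbitVector, fockCoeff, zeroAtInfty_sum_apply, inner_sum]
  refine Finset.sum_congr rfl fun w _ => ?_
  rw [inner_smul_right, orthonormal_iff_ite.1 (hS.orthonormal_orbitVector x)]
  split_ifs
  · rw [MultiSystem.pullWord_apply, mul_one]
  · rw [mul_zero]; rfl

variable {ι : Type*} [Fintype ι]

/-- The matrix of functions, indexed by `ι × W`, which represents a matrix `A` over the covariance
algebra on the words in `W`. -/
noncomputable def fockBlock (S : MultiSystem n X) (A : Matrix ι ι (CovAlg n X))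
    (W : Finset (List (Fin n))) : Matrix (ι × W) (ι × W) C₀(X, ℂ) :=
  Matrix.of fun p q => fockCoeff S (A p.1 q.1) p.2 q.2

/-- The vector of `ℓ²(X × ℤ)^ι` with the coefficients `a` in the orbit vectors at `x` of the words
in `W`. -/
noncomputable def orbitSum (S : MultiSystem n X) (x : X) {W : Finset (List (Fin n))}
    (a : EuclideanSpace ℂ (ι × W)) : PiLp 2 (fun _ : ι => ℓ²(X × ℤ, ℂ)) :=
  WithLp.toLp 2 fun i => ∑ v : W, a (i, v) • orbitVector S x v

theorem norm_orbitSum (hS : S.IsFree) (x : X) {W : Finset (List (Fin n))}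
    (a : EuclideanSpace ℂ (ι × W)) : ‖orbitSum S x a‖ = ‖a‖ := by
  have horth := (hS.orthonormal_orbitVector x).comp ((↑) : W → List (Fin n))
    Subtype.val_injective
  refine (sq_eq_sq₀ (norm_nonneg _) (norm_nonneg _)).1 ?_
  rw [PiLp.norm_sq_eq_of_L2, EuclideanSpace.norm_sq_eq, Fintype.sum_prod_type]
  refine Finset.sum_congr rfl fun i _ => ?_
  simpa [orbitSum] using horth.orthogonalFamily.norm_sum (fun v => a (i, v)) Finset.univ

theorem inner_orbitSum (hS : S.IsFree) (A : Matrix ι ι (CovAlg n X)) (x : X)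
    {W : Finset (List (Fin n))} (a b : EuclideanSpace ℂ (ι × W)) :
    ⟪orbitSum S x a, blockOp (A.map (shiftRep hS).eval) (orbitSum S x b)⟫_ℂ =
      ∑ p, ∑ q, star (a p) * fockBlock S A W p q x * b q := by
  simp only [inner_blockOp, orbitSum, Matrix.map_apply, map_sum, map_smul, sum_inner, inner_sum,
    inner_smul_left, inner_smul_right, ← fockCoeff_apply, Fintype.sum_prod_type, fockBlock,
    Matrix.of_apply, Finset.mul_sum, starRingEnd_apply]
  refine Finset.sum_congr rfl fun i _ => ?_
  conv_rhs => rw [Finset.sum_comm]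
  refine Finset.sum_congr rfl fun j _ => ?_
  rw [Finset.sum_comm]
  exact Finset.sum_congr rfl fun u _ => Finset.sum_congr rfl fun v _ => by ring

theorem norm_fockBlock_apply_le [DecidableEq ι] (hS : S.IsFree) (A : Matrix ι ι (CovAlg n X))
    (W : Finset (List (Fin n))) (x : X) :
    ‖(fockBlock S A W).map fun f => f x‖ ≤ ‖blockOp (A.map (shiftRep hS).eval)‖ := by
  refine matrix_norm_le_of_norm_sum_le (norm_nonneg _) fun a b => ?_
  rw [← norm_orbitSum hS x a, ← norm_orbitSum hS x b]
  refine le_of_eq_of_le (congrArg norm (inner_orbitSum hS A x a b).symm) ?_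
  exact norm_inner_apply_le le_rfl _ _

end Fock

/-! ### The Poisson kernel -/

namespace RowContractiveRep

open scoped InnerProductSpace

variable {n : ℕ} {X : Type u} [TopologicalSpace X] {S : MultiSystem n X}
variable {H : Type u} [NormedAddCommGroup H] [InnerProductSpace ℂ H] [CompleteSpace H]
variable (ρ : RowContractiveRep S H)

theorem inner_defect_star_word (w v : List (Fin n)) (f : C₀(X, ℂ)) (k h : H) :
    ⟪ρ.defect (star (ρ.word (w ++ v)) k),
        ρ.π (S.pullWord v f) (ρ.defect (star (ρ.word v) h))⟫_ℂ =
      ⟪k, ρ.word w (ρ.π f ((ρ.word v * (ρ.defect * ρ.defect) * star (ρ.word v)) h))⟫_ℂ := by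
  have hmul : ρ.word (w ++ v) * ρ.defect * ρ.π (S.pullWord v f) * ρ.defect * star (ρ.word v) =
      ρ.word w * ρ.π f * (ρ.word v * (ρ.defect * ρ.defect) * star (ρ.word v)) := by
    calc ρ.word (w ++ v) * ρ.defect * ρ.π (S.pullWord v f) * ρ.defect * star (ρ.word v)
        = ρ.word w * (ρ.word v * (ρ.defect * ρ.π (S.pullWord v f))) * ρ.defect *
            star (ρ.word v) := by simp only [word_append, mul_assoc]
      _ = ρ.word w * (ρ.word v * ρ.π (S.pullWord v f)) * (ρ.defect * ρ.defect) *
            star (ρ.word v) := by rw [(ρ.commute_defect _).eq]; simp only [mul_assoc]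
      _ = ρ.word w * ρ.π f * (ρ.word v * (ρ.defect * ρ.defect) * star (ρ.word v)) := by
        rw [← π_mul_word]; simp only [mul_assoc]
  have hinner := congrArg (fun A : H →L[ℂ] H => ⟪k, A h⟫_ℂ) hmul
  simp only [mul_apply_eq_comp] at hinner ⊢
  rw [← hinner, ← star_defect, ContinuousLinearMap.star_eq_adjoint,
    ContinuousLinearMap.adjoint_inner_left, ContinuousLinearMap.star_eq_adjoint,
    ContinuousLinearMap.adjoint_inner_left, ← ContinuousLinearMap.star_eq_adjoint, star_defect]

theorem sum_inner_fockCoeff (a : CovAlg n X) {W : Finset (List (Fin n))} {v : List (Fin n)}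
    (hW : ∀ w ∈ a.support, w ++ v ∈ W) (k h : H) :
    ∑ u ∈ W, ⟪ρ.defect (star (ρ.word u) k),
        ρ.π (fockCoeff S a u v) (ρ.defect (star (ρ.word v) h))⟫_ℂ =
      ⟪k, ρ.eval a ((ρ.word v * (ρ.defect * ρ.defect) * star (ρ.word v)) h)⟫_ℂ := by
  rw [eval_apply, inner_sum]
  simp only [fockCoeff, map_sum, sum_apply, inner_sum]
  rw [Finset.sum_comm]
  refine Finset.sum_congr rfl fun w hw => ?_
  rw [Finset.sum_eq_single_of_mem _ (hW w hw) fun u _ hu => by simp [hu], if_pos rfl,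
    inner_defect_star_word]

variable {ι : Type*} [Fintype ι]

/-- The Poisson kernel `h ↦ (D T_v* h)_v`, where `D` is the defect operator, applied to a vector of
`H^ι`. Its components are indexed by the words in `W`, and it is cut off outside `U`. -/
noncomputable def poissonVector (W U : Finset (List (Fin n))) (h : PiLp 2 (fun _ : ι => H)) :
    PiLp 2 (fun _ : ι × W => H) :=
  WithLp.toLp 2 fun p =>
    if (p.2 : List (Fin n)) ∈ U then ρ.defect (star (ρ.word p.2) (h p.1)) else 0

theorem norm_poissonVector_le (W U : Finset (List (Fin n))) (h : PiLp 2 (fun _ : ι => H)) :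
    ‖ρ.poissonVector W U h‖ ≤ ‖h‖ := by
  refine le_of_sq_le_sq ?_ (norm_nonneg _)
  rw [PiLp.norm_sq_eq_of_L2, PiLp.norm_sq_eq_of_L2, Fintype.sum_prod_type]
  refine Finset.sum_le_sum fun i _ => le_trans ?_ (ρ.sum_norm_defect_sq_le W (h i))
  rw [← Finset.sum_coe_sort W]
  refine Finset.sum_le_sum fun v _ => ?_
  simp only [poissonVector]
  split_ifs <;> simp

theorem inner_poissonVector (A : Matrix ι ι (CovAlg n X)) {U W : Finset (List (Fin n))}
    (hUW : U ⊆ W) (hW : ∀ i j, ∀ w ∈ (A i j).support, ∀ v ∈ U, w ++ v ∈ W)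
    (k h : PiLp 2 (fun _ : ι => H)) :
    ⟪ρ.poissonVector W W k, blockOp ((fockBlock S A W).map ρ.π) (ρ.poissonVector W U h)⟫_ℂ =
      ⟪k, blockOp (A.map fun a => ρ.eval a * ρ.defectSum U) h⟫_ℂ := by
  simp only [inner_blockOp, Fintype.sum_prod_type]
  refine Finset.sum_congr rfl fun i _ => ?_
  rw [Finset.sum_comm]
  refine Finset.sum_congr rfl fun j _ => ?_
  rw [Matrix.map_apply, mul_apply_eq_comp, defectSum, sum_apply, map_sum, inner_sum]
  rw [Finset.sum_comm]
  conv_rhs => rw [← Finset.inter_eq_right.2 hUW, ← Finset.sum_ite_mem, ← Finset.sum_coe_sort W]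
  refine Finset.sum_congr rfl fun v _ => ?_
  split_ifs with hv
  · rw [← sum_inner_fockCoeff _ _ (fun w hw => hW i j w hw v hv), ← Finset.sum_coe_sort W]
    simp [poissonVector, fockBlock, hv]
  · simp [poissonVector, hv]

theorem norm_blockOp_eval_mul_defectSum_le (hS : S.IsFree)
    (A : Matrix ι ι (CovAlg n X)) (U : Finset (List (Fin n))) :
    ‖blockOp (A.map fun a => ρ.eval a * ρ.defectSum U)‖ ≤
      ‖blockOp (A.map (shiftRep hS).eval)‖ := by
  classical
  obtain ⟨W, hUW, hW⟩ : ∃ W, U ⊆ W ∧ ∀ i j, ∀ w ∈ (A i j).support, ∀ v ∈ U, w ++ v ∈ W :=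
    ⟨U ∪ ((Finset.univ.biUnion fun p : ι × ι => (A p.1 p.2).support) ×ˢ U).image
      fun p => p.1 ++ p.2, Finset.subset_union_left, fun i j w hw v hv =>
      Finset.mem_union_right _ <| Finset.mem_image_of_mem (fun p => p.1 ++ p.2) <|
        Finset.mk_mem_product (Finset.mem_biUnion.2 ⟨(i, j), Finset.mem_univ _, hw⟩) hv⟩
  refine opNorm_le_of_norm_inner_le (norm_nonneg _) fun k h => ?_
  rw [← ρ.inner_poissonVector A hUW hW]
  have hblock : ‖blockOp ((fockBlock S A W).map ρ.π)‖ ≤ ‖blockOp (A.map (shiftRep hS).eval)‖ :=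
    norm_blockOp_map_le ρ.π (norm_nonneg _) (norm_fockBlock_apply_le hS A W)
  refine (norm_inner_apply_le hblock _ _).trans ?_
  gcongr
  exacts [ρ.norm_poissonVector_le W W k, ρ.norm_poissonVector_le W U h]

end RowContractiveRep

namespace RowContractiveRep

open scoped InnerProductSpace
open Filter Topology

variable {n : ℕ} {X : Type u} [TopologicalSpace X] {S : MultiSystem n X}
variable {H : Type u} [NormedAddCommGroup H] [InnerProductSpace ℂ H] [CompleteSpace H]
variable (ρ : RowContractiveRep S H) {m : ℕ} (A : Matrix (Fin m) (Fin m) (CovAlg n X))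

theorem matrixNorm_le_shiftRep_of_tendsto (hS : S.IsFree)
    (hρ : Tendsto (fun N => ρ.cp^[N] 1) atTop (𝓝 0)) :
    ρ.matrixNorm A ≤ (shiftRep hS).matrixNorm A := by
  refine norm_blockOp_le_of_tendsto (l := atTop)
    (a := fun N => A.map fun a => ρ.eval a * ρ.defectSum (wordsOfLengthLT n N))
    (norm_nonneg _) (fun i j => ?_)
    (Eventually.of_forall fun N => ρ.norm_blockOp_eval_mul_defectSum_le hS A _)
  have hlim : Tendsto (fun N => ρ.eval (A i j) * (1 - ρ.cp^[N] 1)) atTop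
      (𝓝 (ρ.eval (A i j) * (1 - 0))) :=
    tendsto_const_nhds.mul (tendsto_const_nhds.sub hρ)
  rw [sub_zero, mul_one] at hlim
  simpa only [Matrix.map_apply, defectSum_wordsOfLengthLT] using hlim

/-- The representation with `T_i` replaced by `r T_i`. -/
noncomputable def scale (r : unitInterval) : RowContractiveRep S H where
  π := ρ.π
  T i := (r : ℂ) • ρ.T i
  covariant f i := by rw [mul_smul_comm, ρ.covariant, smul_mul_assoc]
  row_contractive h :=
    calc ‖∑ i, ((r : ℂ) • ρ.T i) (h i)‖ ^ 2 = (r : ℝ) ^ 2 * ‖∑ i, ρ.T i (h i)‖ ^ 2 := by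
          simp only [smul_apply, ← Finset.smul_sum, norm_smul, mul_pow]
          simp
      _ ≤ ‖∑ i, ρ.T i (h i)‖ ^ 2 :=
          mul_le_of_le_one_left (sq_nonneg _) (pow_le_one₀ r.2.1 r.2.2)
      _ ≤ ∑ i, ‖h i‖ ^ 2 := ρ.row_contractive h

theorem scale_word (r : unitInterval) (w : List (Fin n)) :
    (ρ.scale r).word w = (r : ℂ) ^ w.length • ρ.word w := by
  induction w with
  | nil => simp
  | cons i w ih =>
    rw [word_cons, ih, word_cons, List.length_cons, pow_succ']
    exact smul_mul_smul_comm _ _ _ _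

theorem scale_eval (r : unitInterval) (a : CovAlg n X) :
    (ρ.scale r).eval a = ∑ w ∈ a.support, (r : ℂ) ^ w.length • (ρ.word w * ρ.π (a w)) :=
  Finset.sum_congr rfl fun w _ =>
    (congrArg (· * ρ.π (a w)) (ρ.scale_word r w)).trans (smul_mul_assoc _ _ _)

theorem scale_one_eval (a : CovAlg n X) : (ρ.scale 1).eval a = ρ.eval a := by
  rw [scale_eval, eval, Finsupp.sum]
  simp

theorem continuous_scale_eval (a : CovAlg n X) : Continuous fun r => (ρ.scale r).eval a := by
  simp only [scale_eval]
  fun_prop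

theorem scale_cp_iterate_one (r : unitInterval) (N : ℕ) :
    (ρ.scale r).cp^[N] 1 = ((r : ℂ) ^ 2) ^ N • ρ.cp^[N] 1 := by
  have hcp : ∀ (c : ℂ) B, (ρ.scale r).cp (c • B) = ((r : ℂ) ^ 2 * c) • ρ.cp B := fun c B => by
    simp only [cp, scale, Finset.smul_sum, star_smul, mul_smul_comm, smul_mul_assoc, smul_smul]
    refine Finset.sum_congr rfl fun i _ => congrArg (· • _) ?_
    rw [← starRingEnd_apply, Complex.conj_ofReal]
    ring
  induction N with
  | zero => simp
  | succ N ih =>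
    rw [Function.iterate_succ_apply', Function.iterate_succ_apply', ih, hcp, ← pow_succ']

theorem tendsto_scale_cp_iterate_one {r : unitInterval} (hr : r < 1) :
    Tendsto (fun N => (ρ.scale r).cp^[N] 1) atTop (𝓝 0) := by
  have hpow : Tendsto (fun N => ((r : ℝ) ^ 2) ^ N) atTop (𝓝 0) :=
    tendsto_pow_atTop_nhds_zero_of_lt_one (sq_nonneg _) (pow_lt_one₀ r.2.1 hr two_ne_zero)
  refine squeeze_zero_norm (fun N => ?_) hpow
  rw [scale_cp_iterate_one, norm_smul]
  simpa using mul_le_of_le_one_right (by positivity) (ρ.norm_cp_iterate_one_le N)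

theorem matrixNorm_le_shiftRep (hS : S.IsFree) : ρ.matrixNorm A ≤ (shiftRep hS).matrixNorm A := by
  have : (𝓝[<] (1 : unitInterval)).NeBot := nhdsLT_neBot_of_exists_lt ⟨0, zero_lt_one⟩
  refine norm_blockOp_le_of_tendsto (l := 𝓝[<] (1 : unitInterval))
    (a := fun r => A.map (ρ.scale r).eval) (norm_nonneg _) (fun i j => ?_)
    (eventually_nhdsWithin_of_forall fun r hr =>
      (ρ.scale r).matrixNorm_le_shiftRep_of_tendsto A hS (ρ.tendsto_scale_cp_iterate_one hr))
  simpa [scale_one_eval] using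
    ((ρ.continuous_scale_eval (A i j)).tendsto 1).mono_left nhdsWithin_le_nhds

theorem shiftRep_isCompletelyIsometric (hS : S.IsFree) :
    (shiftRep hS).IsCompletelyIsometric := by
  intro m A
  have hgreatest : IsGreatest {r : ℝ | ∃ (H : Type u) (_ : NormedAddCommGroup H)
      (_ : InnerProductSpace ℂ H) (_ : CompleteSpace H) (ρ : RowContractiveRep S H),
      r = ρ.matrixNorm A} ((shiftRep hS).matrixNorm A) := by
    refine ⟨⟨_, _, _, _, shiftRep hS, rfl⟩, ?_⟩
    rintro _ ⟨H, _, _, _, ρ, rfl⟩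
    exact ρ.matrixNorm_le_shiftRep A hS
  exact hgreatest.csSup_eq.symm

end RowContractiveRep

/-! ### The Cuntz relations in the C*-envelope -/

section UniqueIndex

variable {ι : Type*} [Fintype ι] [Unique ι]

theorem norm_piLp_of_unique {E : Type*} [SeminormedAddCommGroup E] (h : PiLp 2 fun _ : ι => E) :
    ‖h‖ = ‖h default‖ := by
  simp [PiLp.norm_eq_of_L2]

theorem norm_blockOp_of_unique {H : Type*} [NormedAddCommGroup H] [InnerProductSpace ℂ H]
    (A : H →L[ℂ] H) : ‖blockOp (Matrix.of fun _ _ : ι => A)‖ = ‖A‖ := by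
  have happly : ∀ h, ‖blockOp (Matrix.of fun _ _ : ι => A) h‖ = ‖A (h default)‖ := fun h => by
    simp [norm_piLp_of_unique, blockOp_apply]
  refine le_antisymm (ContinuousLinearMap.opNorm_le_bound _ (norm_nonneg _) fun h => ?_)
    (A.opNorm_le_bound (norm_nonneg (blockOp (Matrix.of fun _ _ : ι => A))) fun x => ?_)
  · rw [happly, norm_piLp_of_unique]
    exact A.le_opNorm _
  · have hle := (blockOp (Matrix.of fun _ _ : ι => A)).le_opNorm (WithLp.toLp 2 fun _ => x)
    rwa [happly, norm_piLp_of_unique] at hle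

end UniqueIndex

namespace RowContractiveRep

open scoped InnerProductSpace

variable {n : ℕ} {X : Type u} [TopologicalSpace X] {S : MultiSystem n X}
variable {H : Type u} [NormedAddCommGroup H] [InnerProductSpace ℂ H] [CompleteSpace H]
variable {H' : Type u} [NormedAddCommGroup H'] [InnerProductSpace ℂ H'] [CompleteSpace H']
variable {ρ : RowContractiveRep S H} {ρ' : RowContractiveRep S H'}

theorem IsCompletelyIsometric.norm_eval_eq (hρ : ρ.IsCompletelyIsometric)
    (hρ' : ρ'.IsCompletelyIsometric) (a : CovAlg n X) : ‖ρ.eval a‖ = ‖ρ'.eval a‖ := by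
  let A : Matrix (Fin 1) (Fin 1) (CovAlg n X) := Matrix.of fun _ _ => a
  calc ‖ρ.eval a‖ = ρ.matrixNorm A := (norm_blockOp_of_unique (ι := Fin 1) (ρ.eval a)).symm
    _ = ρ'.matrixNorm A := (hρ 1 A).trans (hρ' 1 A).symm
    _ = ‖ρ'.eval a‖ := norm_blockOp_of_unique (ι := Fin 1) (ρ'.eval a)

theorem IsCompletelyIsometric.norm_π (hρ : ρ.IsCompletelyIsometric) (hS : S.IsFree)
    (f : C₀(X, ℂ)) : ‖ρ.π f‖ = ‖f‖ := by
  have hnorm := hρ.norm_eval_eq (shiftRep_isCompletelyIsometric hS) (Finsupp.single [] f)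
  rw [eval_single, eval_single, word_nil, word_nil, one_mul, one_mul] at hnorm
  exact hnorm.trans (norm_shiftMul f)

variable (ρ) in
/-- `ρ.eval a` as an element of the generated C*-algebra. -/
noncomputable def evalCstar (a : CovAlg n X) : ρ.cstar :=
  ⟨ρ.eval a, NonUnitalStarSubalgebra.le_topologicalClosure _
    (NonUnitalStarAlgebra.subset_adjoin ℂ _ ⟨a, rfl⟩)⟩

theorem IsCStarEnvelope.exists_hom (hρ : ρ.IsCStarEnvelope) (hρ' : ρ'.IsCompletelyIsometric) :
    ∃ φ : ρ'.cstar →⋆ₙₐ[ℂ] (H →L[ℂ] H), ∀ a, φ (ρ'.evalCstar a) = ρ.eval a := by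
  obtain ⟨q, -, hq⟩ := hρ.2 H' ρ' hρ'
  exact ⟨(NonUnitalStarSubalgebraClass.subtype ρ.cstar).comp q, fun a => hq a _ rfl⟩

variable (ρ) in
theorem sum_eval_mul_star (f : C₀(X, ℂ)) :
    ∑ i, ρ.eval (Finsupp.single [i] (S.pull i f)) * star (ρ.eval (Finsupp.single [i] (S.pull i f)))
      = ρ.π f * ρ.cp 1 * star (ρ.π f) := by
  rw [cp, Finset.mul_sum, Finset.sum_mul]
  refine Finset.sum_congr rfl fun i _ => ?_
  rw [eval_single, word_cons, word_nil, mul_one, ← ρ.covariant, star_mul]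
  simp only [mul_assoc]

theorem star_word_mul_word_shiftRep (hS : S.IsFree) (w : List (Fin n)) :
    star ((shiftRep hS).word w) * (shiftRep hS).word w = 1 := by
  induction w with
  | nil => simp
  | cons i w ih =>
    have hT : star ((shiftRep hS).T i) * (shiftRep hS).T i = 1 := by
      exact (star_shift_mul_shift hS i i).trans (if_pos rfl)
    rw [word_cons, star_mul, mul_assoc, ← mul_assoc (star ((shiftRep hS).T i)), hT, one_mul, ih]

theorem shiftRep_cp_one (hS : S.IsFree) (hsurj : S.IsSurjective) : (shiftRep hS).cp 1 = 1 := by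
  simp only [cp, mul_one]
  exact sum_shift_mul_star_shift hS hsurj

theorem IsCStarEnvelope.star_eval_single_mul_self (hρ : ρ.IsCStarEnvelope) (hS : S.IsFree)
    (w : List (Fin n)) (f : C₀(X, ℂ)) :
    star (ρ.word w * ρ.π f) * (ρ.word w * ρ.π f) = star (ρ.π f) * ρ.π f := by
  obtain ⟨φ, hφ⟩ := hρ.exists_hom (shiftRep_isCompletelyIsometric hS)
  have hshift : star ((shiftRep hS).evalCstar (Finsupp.single w f)) *
        (shiftRep hS).evalCstar (Finsupp.single w f) =
      star ((shiftRep hS).evalCstar (Finsupp.single [] f)) *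
        (shiftRep hS).evalCstar (Finsupp.single [] f) := by
    refine Subtype.ext ?_
    change star ((shiftRep hS).eval _) * (shiftRep hS).eval _ =
      star ((shiftRep hS).eval _) * (shiftRep hS).eval _
    rw [eval_single, eval_single, word_nil, one_mul, star_mul, mul_assoc,
      ← mul_assoc (star ((shiftRep hS).word w)), star_word_mul_word_shiftRep, one_mul]
  simpa only [map_mul, map_star, hφ, eval_single, word_nil, one_mul] using congrArg φ hshift

theorem IsCStarEnvelope.π_mul_cp_one_mul_star (hρ : ρ.IsCStarEnvelope) (hS : S.IsFree)
    (hsurj : S.IsSurjective) (f : C₀(X, ℂ)) :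
    ρ.π f * ρ.cp 1 * star (ρ.π f) = ρ.π f * star (ρ.π f) := by
  obtain ⟨φ, hφ⟩ := hρ.exists_hom (shiftRep_isCompletelyIsometric hS)
  have hshift : ∑ i, (shiftRep hS).evalCstar (Finsupp.single [i] (S.pull i f)) *
        star ((shiftRep hS).evalCstar (Finsupp.single [i] (S.pull i f))) =
      (shiftRep hS).evalCstar (Finsupp.single [] f) *
        star ((shiftRep hS).evalCstar (Finsupp.single [] f)) := by
    refine Subtype.ext ((AddSubmonoidClass.coe_finsetSum _ _).trans ?_)
    refine ((shiftRep hS).sum_eval_mul_star f).trans ?_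
    change _ = (shiftRep hS).eval _ * star ((shiftRep hS).eval _)
    rw [shiftRep_cp_one hS hsurj, mul_one, eval_single, word_nil, one_mul]
  have himage := congrArg φ hshift
  simp only [map_sum, map_mul, map_star, hφ] at himage
  rwa [sum_eval_mul_star, eval_single, word_nil, one_mul] at himage

theorem IsCStarEnvelope.norm_word_π_apply (hρ : ρ.IsCStarEnvelope) (hS : S.IsFree)
    (w : List (Fin n)) (f : C₀(X, ℂ)) (h : H) : ‖ρ.word w (ρ.π f h)‖ = ‖ρ.π f h‖ := by
  have hinner := congrArg (fun A : H →L[ℂ] H => ⟪h, A h⟫_ℂ) (hρ.star_eval_single_mul_self hS w f)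
  simp only [ContinuousLinearMap.star_eq_adjoint, mul_apply_eq_comp,
    ContinuousLinearMap.adjoint_inner_right, inner_self_eq_norm_sq_to_K] at hinner
  exact (sq_eq_sq₀ (norm_nonneg _) (norm_nonneg _)).1 (by exact_mod_cast hinner)

theorem IsCStarEnvelope.cp_one_mul_π (hρ : ρ.IsCStarEnvelope) (hS : S.IsFree)
    (hsurj : S.IsSurjective) (f : C₀(X, ℂ)) : ρ.cp 1 * ρ.π f = ρ.π f := by
  ext h
  have hinner := congrArg (fun A : H →L[ℂ] H => ⟪h, A h⟫_ℂ)
    (hρ.π_mul_cp_one_mul_star hS hsurj (star f))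
  rw [map_star, star_star] at hinner
  simp only [ContinuousLinearMap.star_eq_adjoint, mul_apply_eq_comp,
    ContinuousLinearMap.adjoint_inner_right, inner_self_eq_norm_sq_to_K] at hinner
  refine eq_of_norm_le_re_inner_eq_norm_sq (𝕜 := ℂ) (ρ.norm_cp_one_apply_le _) ?_
  rw [mul_apply_eq_comp, inner_re_symm, hinner]
  norm_cast

theorem star_T_apply_T_self {i : Fin n} {x : H} (hx : ‖ρ.T i x‖ = ‖x‖) :
    star (ρ.T i) (ρ.T i x) = x := by
  have hle : ‖star (ρ.T i) (ρ.T i x)‖ ^ 2 ≤ ‖x‖ ^ 2 :=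
    calc ‖star (ρ.T i) (ρ.T i x)‖ ^ 2 ≤ ∑ j, ‖star (ρ.T j) (ρ.T i x)‖ ^ 2 :=
          Finset.single_le_sum (f := fun j => ‖star (ρ.T j) (ρ.T i x)‖ ^ 2)
            (fun _ _ => sq_nonneg _) (Finset.mem_univ i)
      _ ≤ ‖x‖ ^ 2 := hx ▸ ρ.sum_norm_star_sq_le _
  refine eq_of_norm_le_re_inner_eq_norm_sq (𝕜 := ℂ)
    (abs_le_of_sq_le_sq' hle (norm_nonneg _)).2 ?_
  rw [ContinuousLinearMap.star_eq_adjoint, ContinuousLinearMap.adjoint_inner_left,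
    inner_self_eq_norm_sq, hx]

theorem star_T_apply_T_of_ne {i j : Fin n} (hij : i ≠ j) {x : H} (hx : ‖ρ.T j x‖ = ‖x‖) :
    star (ρ.T i) (ρ.T j x) = 0 := by
  have hsum : ‖star (ρ.T i) (ρ.T j x)‖ ^ 2 + ‖star (ρ.T j) (ρ.T j x)‖ ^ 2 ≤ ‖x‖ ^ 2 := by
    rw [← Finset.sum_pair (f := fun i => ‖star (ρ.T i) (ρ.T j x)‖ ^ 2) hij, ← hx]
    exact (Finset.sum_le_sum_of_subset_of_nonneg (Finset.subset_univ _)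
      fun _ _ _ => sq_nonneg _).trans (ρ.sum_norm_star_sq_le _)
  rw [star_T_apply_T_self hx, add_le_iff_nonpos_left] at hsum
  exact norm_eq_zero.1 (pow_eq_zero_iff two_ne_zero |>.1 (hsum.antisymm (sq_nonneg _)))

/-- The Cuntz relations, together with faithfulness of `π`. As `π` may be degenerate, `T_i` need
not be an isometry on all of `H`, so the relation `T_i* T_j = δ_{ij}` is only asked for on the
ranges of the operators `T_u π(f)`. -/
structure IsCuntz (ρ : RowContractiveRep S H) : Prop where
  star_T_mul : ∀ (i j : Fin n) (u : List (Fin n)) (f : C₀(X, ℂ)),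
    star (ρ.T i) * (ρ.T j * (ρ.word u * ρ.π f)) = if i = j then ρ.word u * ρ.π f else 0
  sum_eq : ∀ f : C₀(X, ℂ), ∑ i, ρ.T i * ρ.π (S.pull i f) * star (ρ.T i) = ρ.π f
  norm_π : ∀ f : C₀(X, ℂ), ‖ρ.π f‖ = ‖f‖

theorem IsCStarEnvelope.isCuntz (hρ : ρ.IsCStarEnvelope) (hS : S.IsFree)
    (hsurj : S.IsSurjective) : ρ.IsCuntz where
  star_T_mul i j u f := by
    ext h
    have hnorm : ‖ρ.T j (ρ.word u (ρ.π f h))‖ = ‖ρ.word u (ρ.π f h)‖ := by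
      rw [hρ.norm_word_π_apply hS, ← hρ.norm_word_π_apply hS (j :: u), word_cons,
        mul_apply_eq_comp]
    rw [mul_apply_eq_comp, mul_apply_eq_comp, mul_apply_eq_comp]
    split_ifs with hij
    · subst hij
      exact star_T_apply_T_self hnorm
    · exact star_T_apply_T_of_ne hij hnorm
  sum_eq f := by
    rw [← hρ.cp_one_mul_π hS hsurj f, ρ.commute_cp_one f, cp, Finset.mul_sum]
    refine Finset.sum_congr rfl fun i _ => ?_
    rw [← ρ.covariant, mul_one, mul_assoc]
  norm_π := hρ.1.norm_π hS

end RowContractiveRep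

/-! ### Ideals in closures of increasing unions -/

section Approximation

theorem mem_of_mul_one_sub_mem {A : Type*} [NormedRing A] [CompleteSpace A] {J : AddSubgroup A}
    (hJ : IsClosed (J : Set A)) {d : A} (hd : ‖d‖ < 1) (hJd : ∀ a ∈ J, a * d ∈ J) {x : A}
    (hx : x * (1 - d) ∈ J) : x ∈ J := by
  have hsum : HasSum (fun k => x * (1 - d) * d ^ k) x := by
    have hgeom := (summable_geometric_of_norm_lt_one hd).hasSum.mul_left (x * (1 - d))
    rwa [mul_assoc x, mul_neg_geom_series d hd, mul_one] at hgeom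
  have hmem (k : ℕ) : x * (1 - d) * d ^ k ∈ J := by
    induction k with
    | zero => rwa [pow_zero, mul_one]
    | succ k ih => rw [pow_succ, ← mul_assoc]; exact hJd _ ih
  exact hJ.mem_of_tendsto hsum (Filter.Eventually.of_forall fun s => J.sum_mem fun k _ => hmem k)

/-- The cutoff function `t ↦ max (t - δ) 0 / max t δ`, written as a difference so that its distance
to `1` is visible. Through the functional calculus it yields approximate units of ideals. -/
noncomputable def cutoff (δ t : ℝ) : ℝ := 1 - δ / max t δ

theorem continuous_cutoff {δ : ℝ} (hδ : 0 < δ) : Continuous (cutoff δ) :=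
  continuous_const.sub (continuous_const.div (continuous_id.max continuous_const)
    fun _ => (lt_max_of_lt_right hδ).ne')

theorem cutoff_of_le {δ t : ℝ} (hδ : 0 < δ) (ht : t ≤ δ) : cutoff δ t = 0 := by
  rw [cutoff, max_eq_right ht, div_self hδ.ne', sub_self]

variable {A : Type*} [CStarAlgebra A]

theorem cfc_mem_of_isClosed {B : NonUnitalStarSubalgebra ℂ A}
    (hB : IsClosed (B : Set A)) {c : A} (hc : c ∈ B) {g : ℝ → ℝ} (hg : Continuous g)
    (hg0 : g 0 = 0) : cfc g c ∈ B := by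
  rw [← cfcₙ_eq_cfc hg.continuousOn hg0]
  have : IsClosed (B : Set A) := hB
  exact cfcₙ_mem (𝕜' := ℂ) g hc

theorem norm_sub_mul_cfc_cutoff_sq_le (a : A) {δ : ℝ} (hδ : 0 < δ) :
    ‖a - a * cfc (cutoff δ) (star a * a)‖ ^ 2 ≤ δ := by
  set c : A := star a * a with hc
  let k : ℝ → ℝ := fun t => 1 - cutoff δ t
  have hkc : Continuous k := continuous_const.sub (continuous_cutoff hδ)
  have hk : a - a * cfc (cutoff δ) c = a * cfc k c := by
    rw [cfc_sub (fun _ => (1 : ℝ)) (cutoff δ) c continuous_const.continuousOn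
      (continuous_cutoff hδ).continuousOn, cfc_const_one ℝ c, mul_sub, mul_one]
  have hksa : star (cfc k c) = cfc k c := (cfc_predicate k c : IsSelfAdjoint (cfc k c)).star_eq
  have hsq : star (a * cfc k c) * (a * cfc k c) = cfc (fun t => k t * t * k t) c := by
    rw [star_mul, hksa, cfc_mul (fun t => k t * t) k c (hkc.mul continuous_id).continuousOn
      hkc.continuousOn, cfc_mul k (fun t => t) c hkc.continuousOn continuous_id.continuousOn,
      cfc_id' ℝ c, hc]
    simp only [mul_assoc]
  rw [hk, sq, ← CStarRing.norm_star_mul_self, hsq]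
  refine norm_cfc_le hδ.le fun t ht => ?_
  have ht0 : 0 ≤ t := spectrum_star_mul_self_nonneg t ht
  have hkt : k t = δ / max t δ := sub_sub_cancel _ _
  have hmax : 0 < max t δ := lt_max_of_lt_right hδ
  rw [hkt, Real.norm_of_nonneg (by positivity)]
  calc δ / max t δ * t * (δ / max t δ) = δ * (δ / max t δ) * (t / max t δ) := by ring
    _ ≤ δ * 1 * 1 := by
      gcongr
      · exact (div_le_one hmax).2 (le_max_right _ _)
      · exact (div_le_one hmax).2 (le_max_left _ _)
    _ = δ := by ring

theorem cfc_cutoff_mem {B : NonUnitalStarSubalgebra ℂ A} (hB : IsClosed (B : Set A))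
    {J : Submodule ℂ A} (hJ : IsClosed (J : Set A)) (hl : ∀ b ∈ B, ∀ a ∈ J, b * a ∈ J)
    (hr : ∀ b ∈ B, ∀ a ∈ J, a * b ∈ J) (hmul : ∀ a ∈ J, ∀ b ∈ J, a * b ∈ J) {c j : A}
    (hc : IsSelfAdjoint c) (hcB : c ∈ B) (hj : j ∈ J) {δ : ℝ} (hδ : ‖c - j‖ < δ) :
    cfc (cutoff δ) c ∈ J := by
  have hδ0 : 0 < δ := (norm_nonneg _).trans_lt hδ
  have hmax (t : ℝ) : 0 < max t δ := lt_max_of_lt_right hδ0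
  let r : ℝ → ℝ := fun t => max t 0 / max t δ ^ 2
  have hrc : Continuous r := (continuous_id.max continuous_const).div
    ((continuous_id.max continuous_const).pow 2) fun t => (pow_pos (hmax t) 2).ne'
  have hrB : cfc r c ∈ B := cfc_mem_of_isClosed hB hcB hrc (by simp [r])
  have hpB : cfc (cutoff δ) c ∈ B := cfc_mem_of_isClosed hB hcB
    (continuous_cutoff hδ0) (cutoff_of_le hδ0 hδ0.le)
  have hinv : cfc (cutoff δ) c * (cfc r c * c) = cfc (cutoff δ) c := by
    nth_rw 3 [← cfc_id' ℝ c]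
    rw [← cfc_mul r (fun t => t) c hrc.continuousOn continuousOn_id,
      ← cfc_mul (cutoff δ) (fun t => r t * t) c (continuous_cutoff hδ0).continuousOn
        (hrc.mul continuous_id).continuousOn]
    congr 1
    funext t
    rcases le_or_gt t δ with ht | ht
    · rw [cutoff_of_le hδ0 ht, zero_mul]
    · have ht0 : t ≠ 0 := (hδ0.trans ht).ne'
      simp only [r, max_eq_left ht.le, max_eq_left (hδ0.trans ht).le]
      field_simp
  have hnorm : ‖cfc r c‖ ≤ δ⁻¹ := by
    refine norm_cfc_le (inv_nonneg.2 hδ0.le) fun t _ => ?_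
    have hr0 : 0 ≤ r t := by positivity
    have hrt : r t ≤ (max t δ)⁻¹ := by
      rw [← one_div, div_le_div_iff₀ (pow_pos (hmax t) 2) (hmax t), one_mul, sq]
      gcongr
    exact (Real.norm_of_nonneg hr0).trans_le (hrt.trans (inv_anti₀ hδ0 (le_max_right _ _)))
  -- `r(c)` inverts `c` under the cutoff, so `cutoff(c) (1 - r(c) (c - j)) = cutoff(c) r(c) j`.
  refine mem_of_mul_one_sub_mem (J := J.toAddSubgroup) hJ (d := cfc r c * (c - j)) ?_ ?_ ?_
  · calc ‖cfc r c * (c - j)‖ ≤ δ⁻¹ * ‖c - j‖ := (norm_mul_le _ _).trans (by gcongr)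
      _ < δ⁻¹ * δ := by gcongr
      _ = 1 := inv_mul_cancel₀ hδ0.ne'
  · intro a ha
    change a * _ ∈ J
    rw [mul_sub, mul_sub, ← mul_assoc, ← mul_assoc]
    have har := hr _ hrB _ ha
    exact J.sub_mem (hr _ hcB _ har) (hmul _ har _ hj)
  · change _ ∈ J
    rw [mul_sub (cfc r c), mul_sub, mul_sub, mul_one, hinv, sub_sub_cancel]
    exact hl _ hpB _ (hl _ hrB _ hj)

theorem mem_closure_iUnion_inter {ι : Type*} {B : ι → NonUnitalStarSubalgebra ℂ A}
    (hB : ∀ k, IsClosed (B k : Set A)) {J : Submodule ℂ A} (hJ : IsClosed (J : Set A))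
    (hl : ∀ k, ∀ b ∈ B k, ∀ a ∈ J, b * a ∈ J) (hr : ∀ k, ∀ b ∈ B k, ∀ a ∈ J, a * b ∈ J)
    (hmul : ∀ a ∈ J, ∀ b ∈ J, a * b ∈ J) {b : A} (hbJ : b ∈ J)
    (hb : b ∈ closure (⋃ k, (B k : Set A))) : b ∈ closure (⋃ k, (B k ∩ J : Set A)) := by
  refine Metric.mem_closure_iff.2 fun ε hε => ?_
  have hU : IsOpen {a : A | ‖star a * a - star a * b‖ < (ε / 2) ^ 2 ∧ dist b a < ε / 2} := by
    exact (isOpen_lt (f := fun a => ‖star a * a - star a * b‖) (by fun_prop) (by fun_prop)).inter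
      (isOpen_lt (f := fun a => dist b a) (by fun_prop) (by fun_prop))
  obtain ⟨a, ⟨hab, hdist⟩, ha⟩ := mem_closure_iff.1 hb _ hU ⟨by simp [hε], by simp [hε]⟩
  obtain ⟨k, hak⟩ := Set.mem_iUnion.1 ha
  have hp : cfc (cutoff ((ε / 2) ^ 2)) (star a * a) ∈ J :=
    cfc_cutoff_mem (hB k) hJ (hl k) (hr k) hmul (.star_mul_self a)
      (mul_mem (star_mem hak) hak) (hl k _ (star_mem hak) _ hbJ) hab
  have hpB : cfc (cutoff ((ε / 2) ^ 2)) (star a * a) ∈ B k :=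
    cfc_mem_of_isClosed (hB k) (mul_mem (star_mem hak) hak)
      (continuous_cutoff (by positivity)) (cutoff_of_le (by positivity) (by positivity))
  refine ⟨a * cfc (cutoff ((ε / 2) ^ 2)) (star a * a),
    Set.mem_iUnion.2 ⟨k, mul_mem hak hpB, hl k _ hak _ hp⟩, ?_⟩
  have hsq := norm_sub_mul_cfc_cutoff_sq_le a (δ := (ε / 2) ^ 2) (by positivity)
  calc dist b _ ≤ dist b a + dist a _ := dist_triangle _ _ _
    _ < ε / 2 + ε / 2 := by
      rw [dist_eq_norm a]
      exact add_lt_add_of_lt_of_le hdist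
        ((sq_le_sq₀ (norm_nonneg _) (by positivity)).1 hsq)
    _ = ε := add_halves ε

end Approximation

/-! ### The levels of `𝔅` -/

namespace RowContractiveRep

variable {n : ℕ} {X : Type u} [TopologicalSpace X] {S : MultiSystem n X}
variable {H : Type u} [NormedAddCommGroup H] [InnerProductSpace ℂ H] [CompleteSpace H]
variable (ρ : RowContractiveRep S H)

/-- The spanning elements `t_u f t_v*` of `𝔅`. -/
noncomputable def gen (u : List (Fin n)) (f : C₀(X, ℂ)) (v : List (Fin n)) : H →L[ℂ] H :=
  ρ.word u * ρ.π f * star (ρ.word v)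

theorem continuous_π : Continuous ρ.π :=
  AddMonoidHomClass.continuous_of_bound ρ.π 1 fun f => by
    simpa using NonUnitalStarAlgHom.norm_apply_le ρ.π f

theorem continuous_gen (u v : List (Fin n)) : Continuous fun f => ρ.gen u f v :=
  (continuous_const.mul ρ.continuous_π).mul continuous_const

@[simp]
theorem gen_nil (f : C₀(X, ℂ)) : ρ.gen [] f [] = ρ.π f := by simp [gen]

theorem star_gen (u v : List (Fin n)) (f : C₀(X, ℂ)) :
    star (ρ.gen u f v) = ρ.gen v (star f) u := by
  simp [gen, mul_assoc, map_star]

variable {ρ}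

namespace IsCuntz

theorem star_word_mul (hρ : ρ.IsCuntz) {v w : List (Fin n)} (hl : v.length = w.length)
    (f : C₀(X, ℂ)) :
    star (ρ.word v) * (ρ.word w * ρ.π f) = if v = w then ρ.π f else 0 := by
  induction v generalizing w with
  | nil =>
    obtain rfl : w = [] := List.length_eq_zero_iff.1 hl.symm
    simp
  | cons i v ih =>
    obtain ⟨j, w, rfl⟩ := List.exists_cons_of_length_eq_add_one hl.symm
    rw [word_cons, word_cons, star_mul, mul_assoc, mul_assoc, hρ.star_T_mul]
    by_cases hij : i = j
    · simp [hij, ih (Nat.succ_injective hl)]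
    · simp [hij]

theorem π_mul_star_word (hρ : ρ.IsCuntz) {v w : List (Fin n)} (hl : v.length = w.length)
    (f : C₀(X, ℂ)) :
    ρ.π f * (star (ρ.word v) * ρ.word w) = if v = w then ρ.π f else 0 := by
  have hstar := congrArg star (hρ.star_word_mul hl.symm (star f))
  rw [star_mul, star_mul, star_star, ← map_star, star_star, mul_assoc] at hstar
  rw [hstar, apply_ite star, ← map_star, star_star, star_zero, if_congr eq_comm rfl rfl]

theorem star_word_gen_word (hρ : ρ.IsCuntz) {u v u' v' : List (Fin n)}
    (hu : u'.length = u.length) (hv : v.length = v'.length) (f : C₀(X, ℂ)) :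
    star (ρ.word u') * ρ.gen u f v * ρ.word v' = if u' = u ∧ v = v' then ρ.π f else 0 := by
  have hassoc : star (ρ.word u') * ρ.gen u f v * ρ.word v' =
      star (ρ.word u') * (ρ.word u * ρ.π f) * (star (ρ.word v) * ρ.word v') := by
    simp only [gen, mul_assoc]
  rw [hassoc, hρ.star_word_mul hu, ite_mul, zero_mul, hρ.π_mul_star_word hv, ite_and]

theorem gen_mul_gen (hρ : ρ.IsCuntz) {u v w z : List (Fin n)} (hl : v.length = w.length)
    (f g : C₀(X, ℂ)) :
    ρ.gen u f v * ρ.gen w g z = if v = w then ρ.gen u (f * g) z else 0 := by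
  have hassoc : ρ.gen u f v * ρ.gen w g z =
      ρ.word u * ρ.π f * (star (ρ.word v) * (ρ.word w * ρ.π g)) * star (ρ.word z) := by
    simp only [gen, mul_assoc]
  rw [hassoc, hρ.star_word_mul hl]
  split_ifs
  · rw [gen, map_mul, mul_assoc (ρ.word u)]
  · rw [mul_zero, zero_mul]

theorem gen_eq_sum (hρ : ρ.IsCuntz) (u v : List (Fin n)) (f : C₀(X, ℂ)) :
    ρ.gen u f v = ∑ i, ρ.gen (u ++ [i]) (S.pull i f) (v ++ [i]) := by
  rw [gen, ← hρ.sum_eq f, Finset.mul_sum, Finset.sum_mul]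
  refine Finset.sum_congr rfl fun i _ => ?_
  simp only [gen, word_append, word_cons, word_nil, mul_one, star_mul, mul_assoc]

theorem isometry_π (hρ : ρ.IsCuntz) : Isometry ρ.π :=
  AddMonoidHomClass.isometry_of_norm ρ.π hρ.norm_π

end IsCuntz

variable (ρ)

/-- The span of the elements `t_u f t_v*` with `|u| = |v| = k` and `f ∈ I`: for an ideal `I` and
under the Cuntz relations, the matrices over `I` indexed by the words of length `k`. -/
noncomputable def level (I : Submodule ℂ C₀(X, ℂ)) (k : ℕ) : Submodule ℂ (H →L[ℂ] H) :=
  Submodule.span ℂ {b | ∃ (u v : List (Fin n)) (f : C₀(X, ℂ)),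
    u.length = k ∧ v.length = k ∧ f ∈ I ∧ b = ρ.gen u f v}

/-- The closed span of the elements `t_u f t_v*` with `|u| = |v|` and `f ∈ I`, sorted by levels. -/
noncomputable def closedSpan (I : Submodule ℂ C₀(X, ℂ)) : Submodule ℂ (H →L[ℂ] H) :=
  (⨆ k, ρ.level I k).topologicalClosure

variable {ρ} {I : Submodule ℂ C₀(X, ℂ)} {k : ℕ}

theorem gen_mem_level {u v : List (Fin n)} (hu : u.length = k) (hv : v.length = k)
    {f : C₀(X, ℂ)} (hf : f ∈ I) : ρ.gen u f v ∈ ρ.level I k :=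
  Submodule.subset_span ⟨u, v, f, hu, hv, hf, rfl⟩

theorem level_le {J : Submodule ℂ (H →L[ℂ] H)}
    (h : ∀ u v f, u.length = k → v.length = k → f ∈ I → ρ.gen u f v ∈ J) : ρ.level I k ≤ J := by
  refine Submodule.span_le.2 ?_
  rintro _ ⟨u, v, f, hu, hv, hf, rfl⟩
  exact h u v f hu hv hf

theorem isClosed_closedSpan : IsClosed (ρ.closedSpan I : Set (H →L[ℂ] H)) :=
  Submodule.isClosed_topologicalClosure _

theorem level_le_closedSpan : ρ.level I k ≤ ρ.closedSpan I :=
  (le_iSup (ρ.level I) k).trans (Submodule.le_topologicalClosure _)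

theorem gen_mem_closedSpan {u v : List (Fin n)} (h : u.length = v.length) {f : C₀(X, ℂ)}
    (hf : f ∈ I) : ρ.gen u f v ∈ ρ.closedSpan I :=
  level_le_closedSpan (gen_mem_level h rfl hf)

theorem closedSpan_le {J : Submodule ℂ (H →L[ℂ] H)} (hJ : IsClosed (J : Set (H →L[ℂ] H)))
    (h : ∀ u v f, u.length = v.length → f ∈ I → ρ.gen u f v ∈ J) : ρ.closedSpan I ≤ J :=
  Submodule.topologicalClosure_minimal _
    (iSup_le fun _ => level_le fun u v f hu hv => h u v f (hu.trans hv.symm)) hJ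

theorem closedSpan_top : ρ.closedSpan ⊤ = ρ.𝔅 := by
  refine le_antisymm (closedSpan_le (Submodule.isClosed_topologicalClosure _) fun u v f huv _ =>
    Submodule.le_topologicalClosure _ (Submodule.subset_span ⟨u, v, f, huv, rfl⟩)) ?_
  refine Submodule.topologicalClosure_minimal _ (Submodule.span_le.2 ?_) isClosed_closedSpan
  rintro _ ⟨u, v, f, huv, rfl⟩
  exact gen_mem_closedSpan huv trivial

theorem gen_mem_𝔅 {u v : List (Fin n)} (h : u.length = v.length) (f : C₀(X, ℂ)) :
    ρ.gen u f v ∈ ρ.𝔅 :=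
  closedSpan_top (ρ := ρ) ▸ gen_mem_closedSpan h trivial

namespace IsCuntz

theorem level_mono (hρ : ρ.IsCuntz) (hI : ∀ i, ∀ f ∈ I, S.pull i f ∈ I) :
    Monotone (ρ.level I) := by
  refine monotone_nat_of_le_succ fun k => level_le fun u v f hu hv hf => ?_
  rw [hρ.gen_eq_sum]
  exact Submodule.sum_mem _ fun i _ => gen_mem_level (by simp [hu]) (by simp [hv]) (hI i f hf)

theorem closedSpan_eq_closure (hρ : ρ.IsCuntz) (hI : ∀ i, ∀ f ∈ I, S.pull i f ∈ I) :
    (ρ.closedSpan I : Set (H →L[ℂ] H)) = closure (⋃ k, (ρ.level I k : Set (H →L[ℂ] H))) := by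
  rw [closedSpan, Submodule.topologicalClosure_coe,
    Submodule.coe_iSup_of_directed _ (hρ.level_mono hI).directed_le]

theorem mul_mem_level (hρ : ρ.IsCuntz) {I' I'' : Submodule ℂ C₀(X, ℂ)}
    (h : ∀ f ∈ I, ∀ g ∈ I', f * g ∈ I'') {a b : H →L[ℂ] H} (ha : a ∈ ρ.level I k)
    (hb : b ∈ ρ.level I' k) : a * b ∈ ρ.level I'' k := by
  suffices hle : ρ.level I k * ρ.level I' k ≤ ρ.level I'' k from hle (Submodule.mul_mem_mul ha hb)
  rw [level, level, Submodule.span_mul_span, Submodule.span_le]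
  rintro _ ⟨_, ⟨u, v, f, hu, hv, hf, rfl⟩, _, ⟨w, z, g, hw, hz, hg, rfl⟩, rfl⟩
  change ρ.gen u f v * ρ.gen w g z ∈ ρ.level I'' k
  rw [hρ.gen_mul_gen (hv.trans hw.symm)]
  split_ifs
  · exact gen_mem_level hu hz (h f hf g hg)
  · exact Submodule.zero_mem _

theorem mul_mem_closedSpan (hρ : ρ.IsCuntz) {I' I'' : Submodule ℂ C₀(X, ℂ)}
    (hI : ∀ i, ∀ f ∈ I, S.pull i f ∈ I) (hI' : ∀ i, ∀ f ∈ I', S.pull i f ∈ I')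
    (h : ∀ f ∈ I, ∀ g ∈ I', f * g ∈ I'') {a b : H →L[ℂ] H} (ha : a ∈ ρ.closedSpan I)
    (hb : b ∈ ρ.closedSpan I') : a * b ∈ ρ.closedSpan I'' := by
  rw [← SetLike.mem_coe, hρ.closedSpan_eq_closure hI] at ha
  rw [← SetLike.mem_coe, hρ.closedSpan_eq_closure hI'] at hb
  have hlevels : ∀ x ∈ ⋃ k, (ρ.level I k : Set (H →L[ℂ] H)),
      ∀ y ∈ ⋃ k, (ρ.level I' k : Set (H →L[ℂ] H)),
      x * y ∈ (ρ.closedSpan I'' : Set (H →L[ℂ] H)) := by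
    intro x hx y hy
    obtain ⟨k, hx⟩ := Set.mem_iUnion.1 hx
    obtain ⟨l, hy⟩ := Set.mem_iUnion.1 hy
    exact level_le_closedSpan (hρ.mul_mem_level h (hρ.level_mono hI (le_max_left k l) hx)
      (hρ.level_mono hI' (le_max_right k l) hy))
  rw [← SetLike.mem_coe, ← isClosed_closedSpan.closure_eq]
  exact map_mem_closure₂ (f := fun x y : H →L[ℂ] H => x * y) continuous_mul ha hb hlevels

/-- The levels of `𝔅` as `*`-subalgebras. -/
noncomputable def levelAlgebra (hρ : ρ.IsCuntz) (k : ℕ) :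
    NonUnitalStarSubalgebra ℂ (H →L[ℂ] H) where
  __ := ρ.level ⊤ k
  mul_mem' ha hb := hρ.mul_mem_level (I'' := ⊤) (fun _ _ _ _ => trivial) ha hb
  star_mem' ha := by
    refine level_le (J := (ρ.level ⊤ k).comap (starLinearEquiv ℂ).toLinearMap)
      (fun u v f hu hv _ => ?_) ha
    change star (ρ.gen u f v) ∈ ρ.level ⊤ k
    rw [star_gen]
    exact gen_mem_level hv hu trivial

theorem exists_π_eq_star_word_mul_mul_word (hρ : ρ.IsCuntz) {b : H →L[ℂ] H}
    (hb : b ∈ ρ.level I k) {u v : List (Fin n)} (hu : u.length = k) (hv : v.length = k) :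
    ∃ f ∈ I, ρ.π f = star (ρ.word u) * b * ρ.word v := by
  suffices hle : ρ.level I k ≤ (I.map (ρ.π : C₀(X, ℂ) →ₗ[ℂ] (H →L[ℂ] H))).comap
      (ContinuousLinearMap.mulLeftRight ℂ _ (star (ρ.word u)) (ρ.word v)).toLinearMap from hle hb
  refine level_le fun u' v' f hu' hv' hf => ?_
  change star (ρ.word u) * ρ.gen u' f v' * ρ.word v ∈ I.map _
  rw [hρ.star_word_gen_word (hu.trans hu'.symm) (hv'.trans hv.symm)]
  split_ifs
  · exact ⟨f, hf, rfl⟩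
  · exact Submodule.zero_mem _

theorem star_word_mul_mul_word_mem_range (hρ : ρ.IsCuntz) {b : H →L[ℂ] H}
    (hb : b ∈ (ρ.level ⊤ k).topologicalClosure) {u v : List (Fin n)} (hu : u.length = k)
    (hv : v.length = k) : star (ρ.word u) * b * ρ.word v ∈ Set.range ρ.π := by
  rw [← hρ.isometry_π.isClosedEmbedding.isClosed_range.closure_eq]
  refine map_mem_closure (f := fun b => star (ρ.word u) * b * ρ.word v) (by fun_prop) hb
    fun x hx => ?_
  obtain ⟨f, -, hf⟩ := hρ.exists_π_eq_star_word_mul_mul_word hx hu hv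
  exact ⟨f, hf⟩

end IsCuntz

/-- The sum of the `t_u t_u*` over the words `u` of length `k`, a unit for the `k`-th level. -/
noncomputable def levelUnit (ρ : RowContractiveRep S H) (k : ℕ) : H →L[ℂ] H :=
  ∑ u ∈ wordsOfLength n k, ρ.word u * star (ρ.word u)

theorem star_levelUnit : star (ρ.levelUnit k) = ρ.levelUnit k := by
  simp [levelUnit, star_sum]

namespace IsCuntz

theorem levelUnit_mul_gen (hρ : ρ.IsCuntz) {u : List (Fin n)} (hu : u.length = k)
    (f : C₀(X, ℂ)) (v : List (Fin n)) : ρ.levelUnit k * ρ.gen u f v = ρ.gen u f v := by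
  have hassoc (w : List (Fin n)) : ρ.word w * star (ρ.word w) * ρ.gen u f v =
      ρ.word w * (star (ρ.word w) * (ρ.word u * ρ.π f)) * star (ρ.word v) := by
    simp only [gen, mul_assoc]
  rw [levelUnit, Finset.sum_mul, Finset.sum_eq_single u]
  · rw [hassoc, hρ.star_word_mul rfl, if_pos rfl, gen]
  · intro w hw hne
    rw [hassoc, hρ.star_word_mul ((mem_wordsOfLength.1 hw).trans hu.symm), if_neg hne, mul_zero,
      zero_mul]
  · exact fun h => absurd (mem_wordsOfLength.2 hu) h

theorem gen_mul_levelUnit (hρ : ρ.IsCuntz) (u : List (Fin n)) (f : C₀(X, ℂ))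
    {v : List (Fin n)} (hv : v.length = k) : ρ.gen u f v * ρ.levelUnit k = ρ.gen u f v := by
  apply star_injective
  rw [star_mul, star_levelUnit, star_gen, hρ.levelUnit_mul_gen hv]

theorem levelUnit_mul_mul_levelUnit (hρ : ρ.IsCuntz) {b : H →L[ℂ] H}
    (hb : b ∈ (ρ.level I k).topologicalClosure) : ρ.levelUnit k * b * ρ.levelUnit k = b := by
  let L := ContinuousLinearMap.mulLeftRight ℂ (H →L[ℂ] H) (ρ.levelUnit k) (ρ.levelUnit k)
  refine Submodule.topologicalClosure_minimal _ (t := LinearMap.eqLocus L.toLinearMap .id)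
    (level_le fun u v f hu hv _ => ?_) (isClosed_eq L.continuous continuous_id) hb
  change ρ.levelUnit k * ρ.gen u f v * ρ.levelUnit k = ρ.gen u f v
  rw [hρ.levelUnit_mul_gen hu, hρ.gen_mul_levelUnit u f hv]

theorem mem_level_of_forall_star_word_mul_mul_word (hρ : ρ.IsCuntz) {b : H →L[ℂ] H}
    (hb : b ∈ (ρ.level ⊤ k).topologicalClosure)
    (h : ∀ u v f, u.length = k → v.length = k → ρ.π f = star (ρ.word u) * b * ρ.word v → f ∈ I) :
    b ∈ ρ.level I k := by
  rw [← hρ.levelUnit_mul_mul_levelUnit hb, levelUnit, Finset.sum_mul, Finset.sum_mul_sum]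
  refine Submodule.sum_mem _ fun u hu => Submodule.sum_mem _ fun v hv => ?_
  rw [mem_wordsOfLength] at hu hv
  obtain ⟨f, hf⟩ := hρ.star_word_mul_mul_word_mem_range hb hu hv
  have hgen : ρ.word u * star (ρ.word u) * b * (ρ.word v * star (ρ.word v)) = ρ.gen u f v := by
    rw [gen, hf]
    simp only [mul_assoc]
  exact hgen ▸ gen_mem_level hu hv (h u v f hu hv hf)

end IsCuntz

end RowContractiveRep

/-! ### Ideals of `𝔅` and their hulls -/

section ScalarSqrt

theorem inv_sqrt_mul_self (n : ℕ) : (√n : ℂ)⁻¹ * (√n : ℂ)⁻¹ = (n : ℂ)⁻¹ := by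
  rw [← mul_inv, ← Complex.ofReal_mul, Real.mul_self_sqrt n.cast_nonneg, Complex.ofReal_natCast]

theorem star_inv_sqrt (n : ℕ) : star (√n : ℂ)⁻¹ = (√n : ℂ)⁻¹ := by
  rw [star_inv₀, Complex.star_def, Complex.conj_ofReal]

end ScalarSqrt

namespace RowContractiveRep

variable {n : ℕ} {X : Type u} [TopologicalSpace X] {S : MultiSystem n X}
variable {H : Type u} [NormedAddCommGroup H] [InnerProductSpace ℂ H] [CompleteSpace H]
variable (ρ : RowContractiveRep S H)

theorem star_V : star ρ.V = (√n : ℂ)⁻¹ • ∑ i, star (ρ.T i) := by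
  rw [V, star_smul, star_sum, star_inv_sqrt]

theorem α_gen (u v : List (Fin n)) (f : C₀(X, ℂ)) :
    ρ.α (ρ.gen u f v) = (n : ℂ)⁻¹ • ∑ i, ∑ j, ρ.gen (i :: u) f (j :: v) := by
  rw [α, star_V, V]
  simp only [smul_mul_assoc, mul_smul_comm, smul_smul, inv_sqrt_mul_self, Finset.sum_mul,
    Finset.mul_sum, ← Finset.smul_sum, gen, word_cons, star_mul, mul_assoc]
  rw [Finset.sum_comm]

variable {ρ}

theorem IsCuntz.star_word_mul_α_gen_mul_word (hρ : ρ.IsCuntz) (i j : Fin n) (u v : List (Fin n))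
    (f : C₀(X, ℂ)) :
    star (ρ.word (i :: u)) * ρ.α (ρ.gen u f v) * ρ.word (j :: v) = (n : ℂ)⁻¹ • ρ.π f := by
  have hentry (i' j' : Fin n) : star (ρ.word (i :: u)) * ρ.gen (i' :: u) f (j' :: v) *
      ρ.word (j :: v) = if i = i' ∧ j' = j then ρ.π f else 0 := by
    rw [hρ.star_word_gen_word (by simp) (by simp)]
    simp
  simp only [α_gen, mul_smul_comm, smul_mul_assoc, Finset.mul_sum, Finset.sum_mul, hentry, ite_and,
    Finset.sum_ite_eq', Finset.mem_univ, if_true, Finset.sum_ite_irrel, Finset.sum_const_zero,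
    Finset.sum_ite_eq]

variable {J : Submodule ℂ (H →L[ℂ] H)}

/-- The ideal `J ∩ C₀(X)` of `C₀(X)`. -/
noncomputable def functionPart (ρ : RowContractiveRep S H) (J : Submodule ℂ (H →L[ℂ] H)) :
    Submodule ℂ C₀(X, ℂ) :=
  J.comap (ρ.π : C₀(X, ℂ) →ₗ[ℂ] (H →L[ℂ] H))

@[simp]
theorem mem_functionPart {f : C₀(X, ℂ)} : f ∈ ρ.functionPart J ↔ ρ.π f ∈ J := Iff.rfl

/-- The set `F` attached to `J`: the common zeros of `J ∩ C₀(X)`. -/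
def hull (ρ : RowContractiveRep S H) (J : Submodule ℂ (H →L[ℂ] H)) : Set X :=
  {x | ∀ f ∈ ρ.functionPart J, f x = 0}

theorem isClosed_hull : IsClosed (ρ.hull J) := by
  simp only [hull, Set.ofPred_forall]
  exact isClosed_biInter fun f _ => isClosed_eq f.continuous continuous_const

namespace IsIdeal

theorem functionPart_eq (hJ : ρ.IsIdeal J) : ρ.functionPart J = vanishingIdeal (ρ.hull J) := by
  refine le_antisymm (fun f hf x hx => hx f hf) fun f hf => ?_
  refine mem_of_forall_common_zero (fun f g hg => ?_) (hJ.closed.preimage ρ.continuous_π) hf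
  rw [mem_functionPart, map_mul]
  exact hJ.mul_left _ (ρ.gen_nil f ▸ gen_mem_𝔅 rfl f) _ hg

theorem gen_mem_of_star_word_mul_mul_word_eq (hJ : ρ.IsIdeal J) {u v : List (Fin n)}
    {b : H →L[ℂ] H} (hb : b ∈ J) {g : C₀(X, ℂ)} (hg : star (ρ.word u) * b * ρ.word v = ρ.π g) :
    ρ.gen u g v ∈ J := by
  refine map_mem_of_forall_map_mul_mem (ρ.continuous_gen u v) hJ.closed fun e =>
    map_mem_of_forall_map_mul_mem (ρ.continuous_gen u v) hJ.closed fun e' => ?_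
  have hmem := hJ.mul_right _ (gen_mem_𝔅 (u := v) rfl e') _
    (hJ.mul_left _ (gen_mem_𝔅 (u := u) rfl e) _ hb)
  have hgen : ρ.gen u e u * b * ρ.gen v e' v = ρ.gen u (e' * (e * g)) v := by
    calc ρ.gen u e u * b * ρ.gen v e' v
        = ρ.word u * ρ.π e * (star (ρ.word u) * b * ρ.word v) * ρ.π e' * star (ρ.word v) := by
          simp only [gen, mul_assoc]
      _ = ρ.gen u (e' * (e * g)) v := by
          rw [hg, mul_comm e', gen, map_mul, map_mul]
          simp only [mul_assoc]
  exact hgen ▸ hmem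

end IsIdeal

namespace IsCuntz

theorem inter_range_eq_iff (hρ : ρ.IsCuntz) (J : Submodule ℂ (H →L[ℂ] H)) (F : Set X) :
    (J : Set (H →L[ℂ] H)) ∩ Set.range ρ.π = ρ.π '' {f : C₀(X, ℂ) | ∀ x ∈ F, f x = 0} ↔
      ρ.functionPart J = vanishingIdeal F := by
  have himage : (J : Set (H →L[ℂ] H)) ∩ Set.range ρ.π = ρ.π '' ρ.functionPart J :=
    Set.image_preimage_eq_inter_range.symm
  rw [himage]
  exact hρ.isometry_π.injective.image_injective.eq_iff.trans
    (SetLike.coe_set_eq (p := ρ.functionPart J) (q := vanishingIdeal F))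

theorem gen_mem_of_mem (hρ : ρ.IsCuntz) (hJ : ρ.IsIdeal J) {u v w z : List (Fin n)}
    {f : C₀(X, ℂ)} (hf : ρ.gen u f v ∈ J) (hwu : w.length = u.length)
    (hvz : v.length = z.length) : ρ.gen w f z ∈ J := by
  refine map_mem_of_forall_map_mul_mem (ρ.continuous_gen w z) hJ.closed fun e =>
    map_mem_of_forall_map_mul_mem (ρ.continuous_gen w z) hJ.closed fun e' => ?_
  have hmem := hJ.mul_right _ (gen_mem_𝔅 hvz e') _ (hJ.mul_left _ (gen_mem_𝔅 hwu e) _ hf)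
  rwa [hρ.gen_mul_gen rfl, if_pos rfl, hρ.gen_mul_gen rfl, if_pos rfl, mul_comm] at hmem

theorem gen_cons_mem_iff (hρ : ρ.IsCuntz) (hJ : ρ.IsBiInvariantIdeal J) {u v : List (Fin n)}
    (huv : u.length = v.length) (i j : Fin n) (f : C₀(X, ℂ)) :
    ρ.gen (i :: u) f (j :: v) ∈ J ↔ ρ.gen u f v ∈ J := by
  constructor <;> intro h
  · refine hJ.mem_of_map_mem _ (gen_mem_𝔅 huv f) ?_
    rw [α_gen]
    exact J.smul_mem _ <| J.sum_mem fun i' _ => J.sum_mem fun j' _ =>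
      hρ.gen_mem_of_mem hJ.toIsIdeal h rfl rfl
  · have hn : (n : ℂ) ≠ 0 := Nat.cast_ne_zero.2 i.pos.ne'
    refine hJ.gen_mem_of_star_word_mul_mul_word_eq (J.smul_mem (n : ℂ) (hJ.map_mem _ h)) ?_
    rw [mul_smul_comm, smul_mul_assoc, hρ.star_word_mul_α_gen_mul_word, smul_inv_smul₀ hn]

theorem gen_mem_iff (hρ : ρ.IsCuntz) (hJ : ρ.IsBiInvariantIdeal J) {u v : List (Fin n)}
    (huv : u.length = v.length) (f : C₀(X, ℂ)) : ρ.gen u f v ∈ J ↔ f ∈ ρ.functionPart J := by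
  induction u generalizing v with
  | nil =>
    obtain rfl : v = [] := List.length_eq_zero_iff.1 huv.symm
    rw [gen_nil, mem_functionPart]
  | cons i u ih =>
    obtain ⟨j, v, rfl⟩ := List.exists_cons_of_length_eq_add_one huv.symm
    have huv' := Nat.succ_injective huv
    rw [hρ.gen_cons_mem_iff hJ huv', ih huv']

theorem pull_mem_functionPart (hρ : ρ.IsCuntz) (hJ : ρ.IsBiInvariantIdeal J) (i : Fin n)
    {f : C₀(X, ℂ)} (hf : f ∈ ρ.functionPart J) : S.pull i f ∈ ρ.functionPart J := by
  rw [← hρ.gen_mem_iff hJ (u := [i]) (v := [i]) rfl]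
  refine hJ.gen_mem_of_star_word_mul_mul_word_eq (b := ρ.π f) hf ?_
  rw [mul_assoc, π_mul_word, hρ.star_word_mul rfl, if_pos rfl]
  rfl

theorem mem_functionPart_of_forall_pull_mem (hρ : ρ.IsCuntz) (hJ : ρ.IsBiInvariantIdeal J)
    {f : C₀(X, ℂ)} (hf : ∀ i, S.pull i f ∈ ρ.functionPart J) : f ∈ ρ.functionPart J := by
  rw [mem_functionPart, ← gen_nil, hρ.gen_eq_sum]
  exact J.sum_mem fun i _ => (hρ.gen_mem_iff hJ rfl _).2 (hf i)

theorem biInvariant_hull [LocallyCompactSpace X] [T2Space X] (hρ : ρ.IsCuntz)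
    (hS : S.IsFree) (hJ : ρ.IsBiInvariantIdeal J) : S.BiInvariant (ρ.hull J) := by
  refine fun i => ⟨?_, fun x hx => ?_⟩
  · rintro _ ⟨x, hx, rfl⟩ f hf
    exact hx _ (hρ.pull_mem_functionPart hJ i hf)
  · have hclosed : IsClosed (⋃ j, S.map j '' ρ.hull J) :=
      isClosed_iUnion_of_finite fun j => (S.proper j).isClosedMap _ isClosed_hull
    have hmem : S.map i x ∈ ⋃ j, S.map j '' ρ.hull J := by
      by_contra hnot
      obtain ⟨f, hf, hfx⟩ := exists_mem_vanishingIdeal_apply_eq_one hclosed hnot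
      have hfJ : f ∈ ρ.functionPart J := hρ.mem_functionPart_of_forall_pull_mem hJ fun j =>
        hJ.functionPart_eq ▸ fun y hy => hf _ (Set.mem_iUnion.2 ⟨j, y, hy, rfl⟩)
      exact one_ne_zero (hfx.symm.trans (hx f hfJ))
    obtain ⟨j, y, hy, hyx⟩ := Set.mem_iUnion.1 hmem
    rwa [← (hS _ _ _ _ hyx).2]

theorem mem_closedSpan_functionPart (hρ : ρ.IsCuntz) (hJ : ρ.IsBiInvariantIdeal J) {k : ℕ}
    {b : H →L[ℂ] H} (hbJ : b ∈ J) (hb : b ∈ (ρ.level ⊤ k).topologicalClosure) :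
    b ∈ ρ.closedSpan (ρ.functionPart J) :=
  level_le_closedSpan <| hρ.mem_level_of_forall_star_word_mul_mul_word hb fun _ _ f hu hv hf =>
    (hρ.gen_mem_iff hJ (hu.trans hv.symm) f).1
      (hJ.gen_mem_of_star_word_mul_mul_word_eq hbJ hf.symm)

theorem closedSpan_functionPart (hρ : ρ.IsCuntz) (hJ : ρ.IsBiInvariantIdeal J) :
    ρ.closedSpan (ρ.functionPart J) = J := by
  refine le_antisymm (closedSpan_le hJ.closed fun u v f huv hf =>
    (hρ.gen_mem_iff hJ huv f).2 hf) fun b hb => ?_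
  let B (k : ℕ) : NonUnitalStarSubalgebra ℂ (H →L[ℂ] H) := (hρ.levelAlgebra k).topologicalClosure
  have hB𝔅 (k : ℕ) : ∀ x ∈ B k, x ∈ ρ.𝔅 := fun x hx =>
    closedSpan_top (ρ := ρ) ▸
      Submodule.topologicalClosure_minimal _ level_le_closedSpan isClosed_closedSpan hx
  have hb𝔅 : b ∈ closure (⋃ k, (B k : Set (H →L[ℂ] H))) := by
    have hmem : b ∈ (ρ.closedSpan ⊤ : Set (H →L[ℂ] H)) := closedSpan_top (ρ := ρ) ▸ hJ.le hb
    rw [hρ.closedSpan_eq_closure (I := ⊤) fun _ _ _ => trivial] at hmem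
    exact closure_mono (Set.iUnion_mono fun k => subset_closure) hmem
  have happrox := mem_closure_iUnion_inter
    (fun k => (hρ.levelAlgebra k).isClosed_topologicalClosure) hJ.closed
    (fun k x hx => hJ.mul_left x (hB𝔅 k x hx)) (fun k x hx => hJ.mul_right x (hB𝔅 k x hx))
    (fun x hx => hJ.mul_left x (hJ.le hx)) hb hb𝔅
  refine closure_minimal (Set.iUnion_subset fun k x hx => ?_) isClosed_closedSpan happrox
  exact hρ.mem_closedSpan_functionPart hJ hx.2 hx.1

end IsCuntz

end RowContractiveRep

namespace MultiSystem

variable {n : ℕ} {X : Type u} [TopologicalSpace X] {S : MultiSystem n X} {F : Set X}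

theorem BiInvariant.pull_mem_vanishingIdeal (hF : S.BiInvariant F) (i : Fin n)
    (f : C₀(X, ℂ)) (hf : f ∈ vanishingIdeal F) : S.pull i f ∈ vanishingIdeal F :=
  fun x hx => hf _ ((hF i).1 ⟨x, hx, rfl⟩)

theorem BiInvariant.exists_act_eq (hF : S.BiInvariant F)
    (hsurj : S.IsSurjective) (k : ℕ) {x : X} (hx : x ∈ F) :
    ∃ w : List (Fin n), w.length = k ∧ ∃ y ∈ F, S.act w y = x := by
  induction k generalizing x with
  | zero => exact ⟨[], rfl, x, hx, rfl⟩
  | succ k ih =>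
    obtain ⟨i, y, rfl⟩ := hsurj x
    obtain ⟨w, rfl, z, hz, rfl⟩ := ih ((hF i).2 hx)
    exact ⟨i :: w, rfl, z, hz, rfl⟩

end MultiSystem

namespace RowContractiveRep

variable {n : ℕ} {X : Type u} [TopologicalSpace X] {S : MultiSystem n X}
variable {H : Type u} [NormedAddCommGroup H] [InnerProductSpace ℂ H] [CompleteSpace H]
variable {ρ : RowContractiveRep S H} {F : Set X}

theorem norm_T_le (ρ : RowContractiveRep S H) (i : Fin n) : ‖ρ.T i‖ ≤ 1 := by
  rw [← norm_star]
  refine ContinuousLinearMap.opNorm_le_bound _ zero_le_one fun h => ?_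
  rw [one_mul, ← sq_le_sq₀ (norm_nonneg _) (norm_nonneg _)]
  exact (Finset.single_le_sum (f := fun i => ‖star (ρ.T i) h‖ ^ 2) (fun _ _ => sq_nonneg _)
    (Finset.mem_univ i)).trans (ρ.sum_norm_star_sq_le h)

theorem norm_word_le (ρ : RowContractiveRep S H) (w : List (Fin n)) : ‖ρ.word w‖ ≤ 1 := by
  induction w with
  | nil => exact ContinuousLinearMap.norm_id_le
  | cons i w ih =>
    rw [word_cons]
    exact (norm_mul_le _ _).trans (mul_le_one₀ (ρ.norm_T_le i) (norm_nonneg _) ih)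

theorem norm_star_word_mul_mul_word_le (w : List (Fin n)) (b : H →L[ℂ] H) :
    ‖star (ρ.word w) * b * ρ.word w‖ ≤ ‖b‖ :=
  calc ‖star (ρ.word w) * b * ρ.word w‖ ≤ ‖ρ.word w‖ * ‖b‖ * ‖ρ.word w‖ := by
        simpa only [norm_star] using norm_mul₃_le (a := star (ρ.word w)) (b := b) (c := ρ.word w)
    _ ≤ 1 * ‖b‖ * 1 := by gcongr <;> exact ρ.norm_word_le w
    _ = ‖b‖ := by rw [one_mul, mul_one]

theorem mul_mul_mem_closedSpan {I : Submodule ℂ C₀(X, ℂ)} {x y : H →L[ℂ] H}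
    (hgen : ∀ (u v : List (Fin n)) (f : C₀(X, ℂ)), u.length = v.length → f ∈ I →
      x * ρ.gen u f v * y ∈ ρ.closedSpan I)
    {b : H →L[ℂ] H} (hb : b ∈ ρ.closedSpan I) : x * b * y ∈ ρ.closedSpan I := by
  let L := ContinuousLinearMap.mulLeftRight ℂ (H →L[ℂ] H) x y
  exact closedSpan_le (J := (ρ.closedSpan I).comap L.toLinearMap)
    (isClosed_closedSpan.preimage L.continuous) hgen hb

namespace IsCuntz

theorem norm_apply_le_norm_π_sub (hρ : ρ.IsCuntz) (hsurj : S.IsSurjective)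
    (hF : S.BiInvariant F) {x : X} (hx : x ∈ F) (f : C₀(X, ℂ)) {k : ℕ} {b : H →L[ℂ] H}
    (hb : b ∈ ρ.level (vanishingIdeal F) k) : ‖f x‖ ≤ ‖ρ.π f - b‖ := by
  obtain ⟨w, hw, y, hy, rfl⟩ := hF.exists_act_eq hsurj k hx
  obtain ⟨g, hg, hgb⟩ := hρ.exists_π_eq_star_word_mul_mul_word hb hw hw
  have hfw : star (ρ.word w) * ρ.π f * ρ.word w = ρ.π (S.pullWord w f) := by
    rw [mul_assoc, π_mul_word, hρ.star_word_mul rfl, if_pos rfl]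
  calc ‖f (S.act w y)‖ = ‖(S.pullWord w f - g) y‖ := by
        rw [ZeroAtInftyContinuousMap.sub_apply, hg y hy, sub_zero, MultiSystem.pullWord_apply]
    _ ≤ ‖S.pullWord w f - g‖ := zeroAtInfty_norm_apply_le _ _
    _ = ‖star (ρ.word w) * (ρ.π f - b) * ρ.word w‖ := by
        rw [← hρ.norm_π, map_sub, ← hfw, hgb, ← sub_mul, ← mul_sub]
    _ ≤ ‖ρ.π f - b‖ := norm_star_word_mul_mul_word_le w _

theorem functionPart_closedSpan_vanishingIdeal (hρ : ρ.IsCuntz) (hsurj : S.IsSurjective)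
    (hF : S.BiInvariant F) :
    ρ.functionPart (ρ.closedSpan (vanishingIdeal F)) = vanishingIdeal F := by
  refine le_antisymm (fun f hf x hx => ?_) fun f hf =>
    mem_functionPart.2 (ρ.gen_nil f ▸ gen_mem_closedSpan rfl hf)
  have hclosed : IsClosed {b | ‖f x‖ ≤ ‖ρ.π f - b‖} :=
    isClosed_le continuous_const (by fun_prop)
  have hle : ‖f x‖ ≤ ‖ρ.π f - ρ.π f‖ := by
    have hmem : ρ.π f ∈ (ρ.closedSpan (vanishingIdeal F) : Set (H →L[ℂ] H)) := hf
    rw [hρ.closedSpan_eq_closure hF.pull_mem_vanishingIdeal] at hmem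
    exact closure_minimal (Set.iUnion_subset fun k b hb =>
      hρ.norm_apply_le_norm_π_sub hsurj hF hx f hb) hclosed hmem
  rwa [sub_self, norm_zero, norm_le_zero_iff] at hle

theorem star_V_mul_gen (hρ : ρ.IsCuntz) (i : Fin n) (u v : List (Fin n)) (f : C₀(X, ℂ)) :
    star ρ.V * ρ.gen (i :: u) f v = (√n : ℂ)⁻¹ • ρ.gen u f v := by
  have hT (j : Fin n) : star (ρ.T j) * ρ.gen (i :: u) f v = if j = i then ρ.gen u f v else 0 := by
    rw [gen, ← mul_assoc, word_cons, mul_assoc (ρ.T i), hρ.star_T_mul, ite_mul, zero_mul, gen]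
  simp only [star_V, smul_mul_assoc, Finset.sum_mul, hT, Finset.sum_ite_eq', Finset.mem_univ,
    if_true]

theorem gen_mul_V (hρ : ρ.IsCuntz) (j : Fin n) (u v : List (Fin n)) (f : C₀(X, ℂ)) :
    ρ.gen u f (j :: v) * ρ.V = (√n : ℂ)⁻¹ • ρ.gen u f v := by
  apply star_injective
  rw [star_mul, star_gen, hρ.star_V_mul_gen, star_smul, star_gen, star_inv_sqrt]

theorem star_V_mul_gen_mul_V (hρ : ρ.IsCuntz) (i j : Fin n) (u v : List (Fin n))
    (f : C₀(X, ℂ)) :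
    star ρ.V * ρ.gen (i :: u) f (j :: v) * ρ.V = (n : ℂ)⁻¹ • ρ.gen u f v := by
  rw [hρ.star_V_mul_gen, smul_mul_assoc, hρ.gen_mul_V, smul_smul, inv_sqrt_mul_self]

theorem star_V_mul_α_gen_mul_V (hρ : ρ.IsCuntz) (u v : List (Fin n)) (f : C₀(X, ℂ)) :
    star ρ.V * ρ.α (ρ.gen u f v) * ρ.V = ρ.gen u f v := by
  rcases eq_or_ne n 0 with rfl | hn
  · rw [hρ.gen_eq_sum, Finset.univ_eq_empty, Finset.sum_empty, α, mul_zero, zero_mul, mul_zero,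
      zero_mul]
  · have hn : (n : ℂ) ≠ 0 := Nat.cast_ne_zero.2 hn
    simp only [α_gen, mul_smul_comm, smul_mul_assoc, Finset.mul_sum, Finset.sum_mul,
      hρ.star_V_mul_gen_mul_V, Finset.sum_const, Finset.card_univ, Fintype.card_fin,
      ← Nat.cast_smul_eq_nsmul ℂ, smul_inv_smul₀ hn, inv_smul_smul₀ hn]

theorem star_V_mul_α_mul_V (hρ : ρ.IsCuntz) {b : H →L[ℂ] H} (hb : b ∈ ρ.𝔅) :
    star ρ.V * ρ.α b * ρ.V = b := by
  let L := ContinuousLinearMap.mulLeftRight ℂ (H →L[ℂ] H) (star ρ.V) ρ.V ∘L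
    ContinuousLinearMap.mulLeftRight ℂ (H →L[ℂ] H) ρ.V (star ρ.V)
  rw [← closedSpan_top] at hb
  exact closedSpan_le (J := LinearMap.eqLocus L.toLinearMap .id)
    (isClosed_eq L.continuous continuous_id)
    (fun u v f _ _ => hρ.star_V_mul_α_gen_mul_V u v f) hb

variable {I : Submodule ℂ C₀(X, ℂ)}

theorem star_V_mul_mul_V_mem_closedSpan (hρ : ρ.IsCuntz) (hI : ∀ i, ∀ f ∈ I, S.pull i f ∈ I)
    {c : H →L[ℂ] H} (hc : c ∈ ρ.closedSpan I) : star ρ.V * c * ρ.V ∈ ρ.closedSpan I := by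
  refine mul_mul_mem_closedSpan (fun u v f huv hf => ?_) hc
  cases u with
  | nil =>
    obtain rfl : v = [] := List.length_eq_zero_iff.1 huv.symm
    rw [hρ.gen_eq_sum, Finset.mul_sum, Finset.sum_mul]
    refine Submodule.sum_mem _ fun i _ => ?_
    rw [List.nil_append, hρ.star_V_mul_gen_mul_V]
    exact Submodule.smul_mem _ _ (gen_mem_closedSpan rfl (hI i f hf))
  | cons i u =>
    obtain ⟨j, v, rfl⟩ := List.exists_cons_of_length_eq_add_one huv.symm
    rw [hρ.star_V_mul_gen_mul_V]
    exact Submodule.smul_mem _ _ (gen_mem_closedSpan (Nat.succ_injective huv) hf)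

end IsCuntz

theorem α_mem_closedSpan {I : Submodule ℂ C₀(X, ℂ)} {b : H →L[ℂ] H} (hb : b ∈ ρ.closedSpan I) :
    ρ.α b ∈ ρ.closedSpan I := by
  refine mul_mul_mem_closedSpan (fun u v f huv hf => ?_) hb
  rw [← α, α_gen]
  exact Submodule.smul_mem _ _ <| Submodule.sum_mem _ fun i _ => Submodule.sum_mem _ fun j _ =>
    gen_mem_closedSpan (congrArg (· + 1) huv) hf

theorem IsCuntz.isBiInvariantIdeal_closedSpan (hρ : ρ.IsCuntz) {I : Submodule ℂ C₀(X, ℂ)}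
    (hmul : ∀ f, ∀ g ∈ I, f * g ∈ I) (hI : ∀ i, ∀ f ∈ I, S.pull i f ∈ I) :
    ρ.IsBiInvariantIdeal (ρ.closedSpan I) where
  le := closedSpan_le (Submodule.isClosed_topologicalClosure _)
    fun _ _ f huv _ => gen_mem_𝔅 huv f
  closed := isClosed_closedSpan
  mul_left _ hb _ ha := hρ.mul_mem_closedSpan (I := ⊤) (fun _ _ _ => trivial) hI
    (fun f _ => hmul f) (closedSpan_top (ρ := ρ) ▸ hb) ha
  mul_right _ hb _ ha := hρ.mul_mem_closedSpan (I' := ⊤) hI (fun _ _ _ => trivial)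
    (fun f hf g _ => mul_comm g f ▸ hmul g f hf) ha (closedSpan_top (ρ := ρ) ▸ hb)
  map_mem _ := α_mem_closedSpan
  mem_of_map_mem _ hb hαb :=
    hρ.star_V_mul_α_mul_V hb ▸ hρ.star_V_mul_mul_V_mem_closedSpan hI hαb

end RowContractiveRep

/-! ### The covering system -/

namespace MultiSystem

variable {n : ℕ} {X : Type u} [TopologicalSpace X]

/-- The points sent into `K` by some product of `k` of the maps: the possible positions of `x_k`
when `x_0 ∈ K`. -/
def iteratedPreimage (S : MultiSystem n X) (K : Set X) : ℕ → Set X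
  | 0 => K
  | k + 1 => ⋃ i, S.map i ⁻¹' S.iteratedPreimage K k

variable (S : MultiSystem n X)

theorem isFree_covering : S.covering.IsFree := by
  rintro i j ⟨⟨a, x⟩, ha⟩ ⟨⟨b, y⟩, hb⟩ h
  have hindex : cons i a = cons j b := congrArg (fun z : S.Tail => z.1.1) h
  have hpoint : cons (S.map i (x 0)) x = cons (S.map j (y 0)) y :=
    congrArg (fun z : S.Tail => z.1.2) h
  exact ⟨congrFun hindex 0, Subtype.ext (Prod.ext (funext fun k => congrFun hindex (k + 1))
    (funext fun k => congrFun hpoint (k + 1)))⟩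

theorem isSurjective_covering : S.covering.IsSurjective := by
  rintro ⟨⟨i, x⟩, h⟩
  refine ⟨i 0, ⟨(fun k => i (k + 1), fun k => x (k + 1)), fun k => h (k + 1)⟩,
    Subtype.ext (Prod.ext (funext fun k => ?_) (funext fun k => ?_))⟩
  · cases k <;> rfl
  · cases k
    · exact h 0
    · rfl

instance [T2Space X] : T2Space S.Tail :=
  inferInstanceAs (T2Space
    {z : (ℕ → Fin n) × (ℕ → X) // ∀ k, S.map (z.1 k) (z.2 (k + 1)) = z.2 k})

theorem isClosed_setOf_map_eq [T2Space X] :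
    IsClosed {z : (ℕ → Fin n) × (ℕ → X) | ∀ k, S.map (z.1 k) (z.2 (k + 1)) = z.2 k} := by
  have hmap : Continuous fun p : Fin n × X => S.map p.1 p.2 :=
    continuous_prod_of_discrete_left.2 fun i => (S.proper i).continuous
  simp only [Set.ofPred_forall]
  exact isClosed_iInter fun k => isClosed_eq
    (hmap.comp (f := fun z : (ℕ → Fin n) × (ℕ → X) => (z.1 k, z.2 (k + 1))) (by fun_prop))
    (by fun_prop)

theorem isCompact_iteratedPreimage {K : Set X} (hK : IsCompact K) (k : ℕ) :
    IsCompact (S.iteratedPreimage K k) := by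
  induction k with
  | zero => exact hK
  | succ k ih => exact isCompact_iUnion fun i => (S.proper i).isCompact_preimage ih

variable {S} in
theorem Tail.mem_iteratedPreimage (z : S.Tail) {K : Set X} (hz : z.1.2 0 ∈ K) (k : ℕ) :
    z.1.2 k ∈ S.iteratedPreimage K k := by
  induction k with
  | zero => exact hz
  | succ k ih => exact Set.mem_iUnion.2 ⟨z.1.1 k, Set.mem_preimage.2 (z.2 k ▸ ih)⟩

theorem isCompact_setOf_apply_zero_mem [T2Space X] {K : Set X} (hK : IsCompact K) :
    IsCompact {z : S.Tail | z.1.2 0 ∈ K} := by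
  have hprod : IsCompact ((Set.univ : Set (ℕ → Fin n)) ×ˢ
      Set.univ.pi fun k => S.iteratedPreimage K k) :=
    isCompact_univ.prod (isCompact_univ_pi fun k => S.isCompact_iteratedPreimage hK k)
  have hpreimage : {z : S.Tail | z.1.2 0 ∈ K} = Subtype.val ⁻¹' ((Set.univ : Set (ℕ → Fin n)) ×ˢ
      Set.univ.pi fun k => S.iteratedPreimage K k) := by
    ext z
    exact ⟨fun hz => ⟨trivial, fun k _ => z.mem_iteratedPreimage hz k⟩, fun hz => hz.2 0 trivial⟩
  rw [hpreimage]
  exact S.isClosed_setOf_map_eq.isClosedEmbedding_subtypeVal.isCompact_preimage hprod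

instance [LocallyCompactSpace X] [T2Space X] : LocallyCompactSpace S.Tail := by
  have : WeaklyLocallyCompactSpace S.Tail := ⟨fun z => by
    obtain ⟨K, hK, hz⟩ := exists_compact_mem_nhds (z.1.2 0)
    have hcont : Continuous fun z : S.Tail => z.1.2 0 :=
      (continuous_apply 0).comp (continuous_snd.comp continuous_subtype_val)
    exact ⟨_, S.isCompact_setOf_apply_zero_mem hK, hcont.continuousAt hz⟩⟩
  infer_instance

end MultiSystem

theorem corollaryC_general {n : ℕ} {X : Type u} [TopologicalSpace X] [LocallyCompactSpace X]
    [T2Space X] (S : MultiSystem n X) (hS : S.IsSurjective) (hfree : S.IsFree)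
    {K : Type u} [NormedAddCommGroup K] [InnerProductSpace ℂ K] [CompleteSpace K]
    (ρ : RowContractiveRep S K) (hρ : ρ.IsCStarEnvelope) :
    ∃ Φ : {J : Submodule ℂ (K →L[ℂ] K) // ρ.IsBiInvariantIdeal J} →
        {F : Set X // IsClosed F ∧ S.BiInvariant F},
      Function.Bijective Φ ∧
        ∀ J F, Φ J = F ↔ (J.1 : Set (K →L[ℂ] K)) ∩ Set.range ρ.π =
          ρ.π '' {f : C₀(X, ℂ) | ∀ x ∈ F.1, f x = 0} := by
  have hcuntz : ρ.IsCuntz := hρ.isCuntz hfree hS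
  refine ⟨fun J => ⟨ρ.hull J.1, RowContractiveRep.isClosed_hull,
    hcuntz.biInvariant_hull hfree J.2⟩, ⟨fun J J' h => ?_, fun F => ?_⟩, fun J F => ?_⟩
  · have hhull : ρ.hull J.1 = ρ.hull J'.1 := congrArg Subtype.val h
    rw [Subtype.ext_iff, ← hcuntz.closedSpan_functionPart J.2,
      ← hcuntz.closedSpan_functionPart J'.2, J.2.functionPart_eq, J'.2.functionPart_eq, hhull]
  · have hJ := hcuntz.isBiInvariantIdeal_closedSpan
      (I := vanishingIdeal F.1) (fun f g hg x hx => mul_eq_zero_of_right (f x) (hg x hx))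
      F.2.2.pull_mem_vanishingIdeal
    refine ⟨⟨_, hJ⟩, Subtype.ext ((vanishingIdeal_inj RowContractiveRep.isClosed_hull F.2.1).1 ?_)⟩
    rw [← hJ.functionPart_eq, hcuntz.functionPart_closedSpan_vanishingIdeal hS F.2.2]
  · rw [hcuntz.inter_range_eq_iff, J.2.functionPart_eq, Subtype.ext_iff,
      vanishingIdeal_inj RowContractiveRep.isClosed_hull F.2.1]

theorem corollaryC {n : ℕ} {X : Type u} [TopologicalSpace X] [LocallyCompactSpace X] [T2Space X]
    (S : MultiSystem n X) (hS : S.IsSurjective)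
    {K : Type u} [NormedAddCommGroup K] [InnerProductSpace ℂ K] [CompleteSpace K]
    (ρ : RowContractiveRep S.covering K) (hρ : ρ.IsCStarEnvelope) :
    ∃ Φ : {J : Submodule ℂ (K →L[ℂ] K) // ρ.IsBiInvariantIdeal J} →
        {F : Set S.Tail // IsClosed F ∧ S.covering.BiInvariant F},
      Function.Bijective Φ ∧
        ∀ J F, Φ J = F ↔ (J.1 : Set (K →L[ℂ] K)) ∩ Set.range ρ.π =
          ρ.π '' {f : C₀(S.Tail, ℂ) | ∀ x ∈ F.1, f x = 0} :=
  corollaryC_general S.covering S.isSurjective_covering S.isFree_covering ρ hρ
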